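/- Let $n\ge 1$, let $U\subseteq\mathbb R^n$ be open, let $\gamma_{ab}(q)$ be a smooth nondegenerate symmetric metric (of any signature) on $U$ with Levi-Civita connection coefficients $\Gamma^a_{bc}$ and covariant derivative denoted by a semicolon, let $V(q)$ be a smooth potential on $U$ and let $E_0\in\mathbb R$. Indices are raised with $\gamma$, repeated indices are summed, round brackets denote symmetrization and a comma a partial derivative. Consider $$\ddot q^a=-\Gamma^a_{bc}\dot q^b\dot q^c-V^{,a},\qquad \tfrac12\gamma_{ab}\dot q^a\dot q^b+V=E_0 .$$ An *exact quadratic first integral (QFI)* is a function $I=K_{ab}(t,q)\dot q^a\dot q^b+K_a(t,q)\dot q^a+K(t,q)$ with smooth coefficients on $\mathbb R\times U$ and $K_{ab}=K_{ba}$, such that for some functions $\psi(t,q)$, $X_a(t,q)$, after replacing $\ddot q^a$ by the equations of motion, $$\frac{dI}{dt}=\left(\psi+X_c\dot q^c\right)\left(\gamma_{ab}\dot q^a\dot q^b+2(V-E_0)\right)\quad\text{for all } t\in\mathbb R,\ q\in U,\ \dot q\in\mathbb R^n .$$ Two functions of $(t,q,\dot q)$ are called *equal modulo the constraint* if they differ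 by $\varphi(t,q)\left(\gamma_{ab}\dot q^a\dot q^b+2(V-E_0)\right)$ for some function $\varphi$. A smooth symmetric tensor $K_{ab}(q)$ is a *conformal Killing tensor (CKT) with associated vector $X_a(q)$* if $K_{(ab;c)}=X_{(a}\gamma_{bc)}$. Consider the following three types of functions, in which all the fields are smooth on $U$. **Type 1** ($\ell\ge0$): $$I_{(\ell)1}=\Big(-\sum_{k=1}^{\ell}\frac{t^{2k}}{2k}L_{(2k-1)(a;b)}+C_{(0)ab}\Big)\dot q^a\dot q^b+\sum_{k=1}^{\ell}t^{2k-1}L_{(2k-1)a}\dot q^a+\sum_{k=1}^{\ell}\frac{t^{2k}}{2k}L_{(2k-1)a}V^{,a}+G(q),$$ where $C_{(0)ab}$ and $L_{(2k-1)(a;b)}$, $1\le k\le\ell$, are CKTs with associated vectors $X_{(0)a}$ and $Y_{(2k-1)a}$, and $$\begin{aligned} (L_{(2\ell-1)b}V^{,b})_{,a}&=-2L_{(2\ell-1)(a;b)}V^{,b}-2(V-E_0)Y_{(2\ell-1)a}\quad(\text{if }\ell\ge1),\\ (L_{(2k-1)b}V^{,b})_{,a}&=-2L_{(2k-1)(a;b)}V^{,b}-2k(2k+1)L_{(2k+1)a}-2(V-E_0)Y_{(2k-1)a},\quad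 1\le k\le\ell-1,\\ G_{,a}&=2C_{(0)ab}V^{,b}+2(V-E_0)X_{(0)a}-L_{(1)a}, \end{aligned}$$ where the term $L_{(1)a}$ in the last equation is absent if $\ell=0$. **Type 2** ($\ell\ge0$): $$I_{(\ell)2}=\sum_{k=0}^{\ell}\Big(-\frac{t^{2k+1}}{2k+1}L_{(2k)(a;b)}\dot q^a\dot q^b+t^{2k}L_{(2k)a}\dot q^a+\frac{t^{2k+1}}{2k+1}L_{(2k)a}V^{,a}\Big),$$ where $L_{(2k)(a;b)}$, $0\le k\le\ell$, are CKTs with associated vectors $Y_{(2k)a}$, and $$\begin{aligned} (L_{(2\ell)b}V^{,b})_{,a}&=-2L_{(2\ell)(a;b)}V^{,b}-2(V-E_0)Y_{(2\ell)a},\\ (L_{(2k)b}V^{,b})_{,a}&=-2L_{(2k)(a;b)}V^{,b}-2(k+1)(2k+1)L_{(2k+2)a}-2(V-E_0)Y_{(2k)a},\quad 0\le k\le\ell-1. \end{aligned}$$ **Type 3** ($\lambda\in\mathbb R$, $\lambda\neq0$): $$I_{(e)}=e^{\lambda t}\left(-L_{(a;b)}\dot q^a\dot q^b+\lambda L_a\dot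 q^a+L_aV^{,a}\right),$$ where $L_{(a;b)}$ is a CKT with associated vector $Y_a$ and $$(L_bV^{,b})_{,a}=-2L_{(a;b)}V^{,b}-\lambda^2L_a-2(V-E_0)Y_a .$$ Then: 1. Every exact QFI is constant along every motion of energy $E_0$. 2. Every function of type 1, 2 or 3 is an exact QFI. 3. Let $\Lambda\subset\mathbb R\setminus\{0\}$ be finite and let $I$ be an exact QFI whose coefficients $K_{ab}$ and $K_a$ are finite sums of terms $t^p c(q)$, $p\in\mathbb N$, and $e^{\lambda t}d(q)$, $\lambda\in\Lambda$, with smooth coefficient fields (symmetric in the case of $K_{ab}$); nothing is assumed about the form of $K$. Then, modulo the constraint, $I$ is the sum of an integral of type 1, an integral of type 2 and, for each $\lambda\in\Lambda$, an integral of type 3 with exponent $\lambda$. If no powers of $t$ occur in $K_{ab}$ and $K_a$ (purely exponential coefficients), then, modulo the constraint, $I$ is the sum of a smooth function $G(q)$ with $G_{,a}=0$ and of integrals of type 3 with exponents $\lambda\in\Lambda$. 4. The types are independent: if the sum of an integral of type 1, an integral of type 2 and integrals of type 3 with finitely many distinct exponents vanishes modulo the constraint, then each of the summands does. -/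

import Mathlib

open scoped ContDiff

noncomputable section

/-- Points of the coordinate space, and also components of velocities. -/
abbrev Coord (n : ℕ) : Type := Fin n → ℝ

/-- A covector field `L_a(q)`, given by its components. -/
abbrev CovectorField (n : ℕ) : Type := Coord n → Fin n → ℝ

/-- A field `K_{ab}(q)` of twice covariant tensors, given by its components. -/
abbrev TensorField2 (n : ℕ) : Type := Coord n → Fin n → Fin n → ℝ

/-- The partial derivative `∂_a f`. -/
def pd {n : ℕ} (a : Fin n) (f : Coord n → ℝ) (q : Coord n) : ℝ :=
  fderiv ℝ f q (Pi.single a 1)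

/-- An autonomous conservative system with `n` generalized coordinates: an open coordinate domain
`U ⊆ ℝⁿ`, a smooth nondegenerate kinetic metric `γ_{ab}` of arbitrary signature and a smooth
potential `V`. -/
structure ConservativeSystem (n : ℕ) where
  /-- the domain of the generalized coordinates -/
  U : Set (Coord n)
  isOpen_U : IsOpen U
  /-- the kinetic metric -/
  γ : Coord n → Matrix (Fin n) (Fin n) ℝ
  γ_smooth : ∀ a b, ContDiffOn ℝ ∞ (fun q => γ q a b) U
  γ_symm : ∀ q ∈ U, (γ q).IsSymm
  γ_nondegenerate : ∀ q ∈ U, IsUnit (γ q).det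
  /-- the potential -/
  V : Coord n → ℝ
  V_smooth : ContDiffOn ℝ ∞ V U

namespace ConservativeSystem

variable {n : ℕ} (S : ConservativeSystem n)

/-- The connection coefficients `Γ^a_{bc}` of the kinetic metric. -/
def Γ (q : Coord n) (a b c : Fin n) : ℝ :=
  (1 / 2) * ∑ d, (S.γ q)⁻¹ a d *
    (pd b (fun x => S.γ x d c) q + pd c (fun x => S.γ x d b) q - pd d (fun x => S.γ x b c) q)

/-- `V^{,a} = γ^{ab} V_{,b}`. -/
def gradV (q : Coord n) (a : Fin n) : ℝ := ∑ b, (S.γ q)⁻¹ a b * pd b S.V q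

/-- The right-hand side `-Γ^a_{bc} v^b v^c - V^{,a}` of the equations of motion. -/
def accel (q v : Coord n) : Coord n :=
  fun a => -(∑ b, ∑ c, S.Γ q a b c * v b * v c) - S.gradV q a

/-- The total energy `½ γ_{ab} v^a v^b + V`. -/
def energy (q v : Coord n) : ℝ := (1 / 2) * (∑ a, ∑ b, S.γ q a b * v a * v b) + S.V q

/-- The polynomial `γ_{ab} v^a v^b + 2 (V - E₀)`, which vanishes exactly on the energy level `E₀`. -/
def shell (E₀ : ℝ) (q v : Coord n) : ℝ :=
  (∑ a, ∑ b, S.γ q a b * v a * v b) + 2 * (S.V q - E₀)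

/-- The covariant derivative `L_{a;b}`. -/
def covDeriv (L : CovectorField n) (q : Coord n) (a b : Fin n) : ℝ :=
  pd b (fun x => L x a) q - ∑ c, S.Γ q c a b * L q c

/-- The symmetrized covariant derivative `L_{(a;b)}`. -/
def symCov (L : CovectorField n) : TensorField2 n :=
  fun q a b => (1 / 2) * (S.covDeriv L q a b + S.covDeriv L q b a)

/-- The covariant derivative `K_{ab;c}`. -/
def covDeriv2 (K : TensorField2 n) (q : Coord n) (a b c : Fin n) : ℝ :=
  pd c (fun x => K x a b) q - (∑ d, S.Γ q d a c * K q d b) - ∑ d, S.Γ q d b c * K q a d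

/-- The scalar `L_a V^{,a}`. -/
def contrV (L : CovectorField n) (q : Coord n) : ℝ := ∑ a, L q a * S.gradV q a

/-- A smooth scalar on the coordinate domain. -/
def SmoothScalar (G : Coord n → ℝ) : Prop := ContDiffOn ℝ ∞ G S.U

/-- A smooth covector field on the coordinate domain. -/
def SmoothCovector (L : CovectorField n) : Prop := ∀ a, ContDiffOn ℝ ∞ (fun q => L q a) S.U

/-- A smooth symmetric tensor field on the coordinate domain. -/
def SmoothSymTensor (K : TensorField2 n) : Prop :=
  (∀ a b, ContDiffOn ℝ ∞ (fun q => K q a b) S.U) ∧ ∀ q ∈ S.U, ∀ a b, K q a b = K q b a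

/-- `K_{ab}` is a conformal Killing tensor of order two with associated vector `X_a`:
a smooth symmetric tensor with `K_{(ab;c)} = X_{(a} γ_{bc)}`. As `K` and `γ` are symmetric, the
symmetrization is the cyclic one. -/
def IsCKT (K : TensorField2 n) (X : CovectorField n) : Prop :=
  S.SmoothSymTensor K ∧ ∀ q ∈ S.U, ∀ a b c,
    S.covDeriv2 K q a b c + S.covDeriv2 K q b c a + S.covDeriv2 K q c a b =
      X q a * S.γ q b c + X q b * S.γ q c a + X q c * S.γ q a b

end ConservativeSystem

/-- The coefficients of a function `K_{ab}(t,q) v^a v^b + K_a(t,q) v^a + K(t,q)`. -/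
structure QuadraticFunction (n : ℕ) where
  quad : ℝ → TensorField2 n
  lin : ℝ → CovectorField n
  scal : ℝ → Coord n → ℝ

/-- The function with the given coefficients. -/
def QuadraticFunction.eval {n : ℕ} (K : QuadraticFunction n) (t : ℝ) (q v : Coord n) : ℝ :=
  (∑ a, ∑ b, K.quad t q a b * v a * v b) + (∑ a, K.lin t q a * v a) + K.scal t q

namespace ConservativeSystem

variable {n : ℕ} (S : ConservativeSystem n)

/-- The total derivative `dI/dt` of `I(t,q,v)` in which `dq/dt = v` and `dv/dt` is replaced by the
right-hand side of the equations of motion. -/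
def totalDeriv (I : ℝ → Coord n → Coord n → ℝ) (t : ℝ) (q v : Coord n) : ℝ :=
  fderiv ℝ (fun p : ℝ × Coord n × Coord n => I p.1 p.2.1 p.2.2) (t, q, v) (1, v, S.accel q v)

/-- Exact quadratic first integral of the system constrained to the energy `E₀`: the coefficients
are smooth, `K_{ab}` is symmetric, and `dI/dt = (ψ + X_c v^c) (γ_{ab} v^a v^b + 2 (V - E₀))` for all
times, positions and velocities. -/
def IsExactQFI (E₀ : ℝ) (K : QuadraticFunction n) : Prop :=
  (∀ a b, ContDiffOn ℝ ∞ (fun p : ℝ × Coord n => K.quad p.1 p.2 a b) (Set.univ ×ˢ S.U)) ∧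
  (∀ a, ContDiffOn ℝ ∞ (fun p : ℝ × Coord n => K.lin p.1 p.2 a) (Set.univ ×ˢ S.U)) ∧
  ContDiffOn ℝ ∞ (fun p : ℝ × Coord n => K.scal p.1 p.2) (Set.univ ×ˢ S.U) ∧
  (∀ t, ∀ q ∈ S.U, ∀ a b, K.quad t q a b = K.quad t q b a) ∧
  ∃ (ψ : ℝ → Coord n → ℝ) (X : ℝ → CovectorField n), ∀ t, ∀ q ∈ S.U, ∀ v,
    S.totalDeriv K.eval t q v = (ψ t q + ∑ c, X t q c * v c) * S.shell E₀ q v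

/-- `q` is a motion of energy `E₀` on the time interval `J`, with velocity `q'`. -/
def IsConstrainedMotion (E₀ : ℝ) (J : Set ℝ) (q q' : ℝ → Coord n) : Prop :=
  ∀ t ∈ J, q t ∈ S.U ∧ HasDerivAt q (q' t) t ∧ HasDerivAt q' (S.accel (q t) (q' t)) t ∧
    S.energy (q t) (q' t) = E₀

/-- `I` is constant along every motion of energy `E₀`. -/
def IsConserved (E₀ : ℝ) (I : ℝ → Coord n → Coord n → ℝ) : Prop :=
  ∀ (J : Set ℝ) (q q' : ℝ → Coord n), IsOpen J → J.OrdConnected →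
    S.IsConstrainedMotion E₀ J q q' →
    ∀ s ∈ J, ∀ t ∈ J, I s (q s) (q' s) = I t (q t) (q' t)

/-- `F` and `H` agree modulo the energy constraint: they differ by a multiple `φ(t,q)` of
`γ_{ab} v^a v^b + 2 (V - E₀)`. -/
def CongrShell (E₀ : ℝ) (F H : ℝ → Coord n → Coord n → ℝ) : Prop :=
  ∃ φ : ℝ → Coord n → ℝ, ∀ t, ∀ q ∈ S.U, ∀ v, F t q v - H t q v = φ t q * S.shell E₀ q v

/-- The integral `I_{(ℓ)1}`; only the `L_{(j)}` with odd `j ≤ 2ℓ - 1` occur. -/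
def integralOne (ℓ : ℕ) (C : TensorField2 n) (L : ℕ → CovectorField n) (G : Coord n → ℝ) :
    QuadraticFunction n where
  quad t q a b :=
    -(∑ k ∈ Finset.Icc 1 ℓ, t ^ (2 * k) / (2 * k : ℝ) * S.symCov (L (2 * k - 1)) q a b) + C q a b
  lin t q a := ∑ k ∈ Finset.Icc 1 ℓ, t ^ (2 * k - 1) * L (2 * k - 1) q a
  scal t q :=
    (∑ k ∈ Finset.Icc 1 ℓ, t ^ (2 * k) / (2 * k : ℝ) * S.contrV (L (2 * k - 1)) q) + G q

/-- The conditions on the data of `I_{(ℓ)1}`. -/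
def CondOne (E₀ : ℝ) (ℓ : ℕ) (C : TensorField2 n) (L : ℕ → CovectorField n) (G : Coord n → ℝ) :
    Prop :=
  S.SmoothScalar G ∧ (∀ k ∈ Finset.Icc 1 ℓ, S.SmoothCovector (L (2 * k - 1))) ∧
  ∃ (X : CovectorField n) (Y : ℕ → CovectorField n),
    S.IsCKT C X ∧
    (∀ k ∈ Finset.Icc 1 ℓ, S.IsCKT (S.symCov (L (2 * k - 1))) (Y (2 * k - 1))) ∧
    (1 ≤ ℓ → ∀ q ∈ S.U, ∀ a,
      pd a (S.contrV (L (2 * ℓ - 1))) q =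
        -2 * (∑ b, S.symCov (L (2 * ℓ - 1)) q a b * S.gradV q b)
          - 2 * (S.V q - E₀) * Y (2 * ℓ - 1) q a) ∧
    (∀ k, 1 ≤ k → k < ℓ → ∀ q ∈ S.U, ∀ a,
      pd a (S.contrV (L (2 * k - 1))) q =
        -2 * (∑ b, S.symCov (L (2 * k - 1)) q a b * S.gradV q b)
          - 2 * (k : ℝ) * (2 * k + 1) * L (2 * k + 1) q a
          - 2 * (S.V q - E₀) * Y (2 * k - 1) q a) ∧
    (∀ q ∈ S.U, ∀ a,
      pd a G q = 2 * (∑ b, C q a b * S.gradV q b) + 2 * (S.V q - E₀) * X q a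
        - (if 0 < ℓ then L 1 q a else 0))

/-- The integral `I_{(ℓ)2}`; only the `L_{(j)}` with even `j ≤ 2ℓ` occur. -/
def integralTwo (ℓ : ℕ) (L : ℕ → CovectorField n) : QuadraticFunction n where
  quad t q a b := ∑ k ∈ Finset.range (ℓ + 1),
    -(t ^ (2 * k + 1) / (2 * k + 1 : ℝ) * S.symCov (L (2 * k)) q a b)
  lin t q a := ∑ k ∈ Finset.range (ℓ + 1), t ^ (2 * k) * L (2 * k) q a
  scal t q := ∑ k ∈ Finset.range (ℓ + 1),
    t ^ (2 * k + 1) / (2 * k + 1 : ℝ) * S.contrV (L (2 * k)) q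

/-- The conditions on the data of `I_{(ℓ)2}`. -/
def CondTwo (E₀ : ℝ) (ℓ : ℕ) (L : ℕ → CovectorField n) : Prop :=
  (∀ k ≤ ℓ, S.SmoothCovector (L (2 * k))) ∧
  ∃ Y : ℕ → CovectorField n,
    (∀ k ≤ ℓ, S.IsCKT (S.symCov (L (2 * k))) (Y (2 * k))) ∧
    (∀ q ∈ S.U, ∀ a,
      pd a (S.contrV (L (2 * ℓ))) q =
        -2 * (∑ b, S.symCov (L (2 * ℓ)) q a b * S.gradV q b)
          - 2 * (S.V q - E₀) * Y (2 * ℓ) q a) ∧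
    (∀ k < ℓ, ∀ q ∈ S.U, ∀ a,
      pd a (S.contrV (L (2 * k))) q =
        -2 * (∑ b, S.symCov (L (2 * k)) q a b * S.gradV q b)
          - 2 * (k + 1 : ℝ) * (2 * k + 1) * L (2 * k + 2) q a
          - 2 * (S.V q - E₀) * Y (2 * k) q a)

/-- The integral `I_{(e)}` with exponent `lam`. -/
def integralExp (lam : ℝ) (L : CovectorField n) : QuadraticFunction n where
  quad t q a b := Real.exp (lam * t) * -S.symCov L q a b
  lin t q a := Real.exp (lam * t) * (lam * L q a)
  scal t q := Real.exp (lam * t) * S.contrV L q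

/-- The conditions on the data of `I_{(e)}`. -/
def CondExp (E₀ lam : ℝ) (L : CovectorField n) : Prop :=
  S.SmoothCovector L ∧
  ∃ Y : CovectorField n,
    S.IsCKT (S.symCov L) Y ∧
    ∀ q ∈ S.U, ∀ a,
      pd a (S.contrV L) q =
        -2 * (∑ b, S.symCov L q a b * S.gradV q b) - lam ^ 2 * L q a
          - 2 * (S.V q - E₀) * Y q a

/-- The coefficients `K_{ab}` and `K_a` are of the form
`∑_{p<m} t^p c_p(q) + ∑_{lam ∈ Λ} e^{lam t} d_lam(q)`, with smooth `c_p` and `d_lam`. Nothing is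
required of the scalar `K(t,q)`. -/
def HasPolyExpCoeffs (m : ℕ) (Λ : Finset ℝ) (K : QuadraticFunction n) : Prop :=
  ∃ (C : ℕ → TensorField2 n) (L : ℕ → CovectorField n)
    (D : ℝ → TensorField2 n) (M : ℝ → CovectorField n),
    (∀ p < m, S.SmoothSymTensor (C p) ∧ S.SmoothCovector (L p)) ∧
    (∀ lam ∈ Λ, S.SmoothSymTensor (D lam) ∧ S.SmoothCovector (M lam)) ∧
    ∀ t, ∀ q ∈ S.U,
      (∀ a b, K.quad t q a b =
        (∑ p ∈ Finset.range m, t ^ p * C p q a b) + ∑ lam ∈ Λ, Real.exp (lam * t) * D lam q a b) ∧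
      (∀ a, K.lin t q a =
        (∑ p ∈ Finset.range m, t ^ p * L p q a) + ∑ lam ∈ Λ, Real.exp (lam * t) * M lam q a)

end ConservativeSystem

end

/-!
Write `dI/dt`, with the equations of motion inserted, as a polynomial of degree three in the
velocity `v`. Comparing its homogeneous parts with those of
`(ψ + X_c v^c) (γ_{ab} v^a v^b + 2 (V - E₀))` turns exactness into four equations for the
coefficients (`CoeffEquations`, `isExactQFI_iff`): a conformal Killing equation for `K_{ab}`,
`∂K_{ab}/∂t + K_{(a;b)} = ψ γ_{ab}`, an equation for `K_{,a}` and one for `∂K/∂t`.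

All three types are members of one family (`familyQFI`): for functions of time `g_i` and covector
fields `L_i`, the quadratic, linear and scalar coefficients are `C - ∑ g_i L_{i(a;b)}`,
`∑ g_i' L_{ia}` and `G + ∑ g_i L_{ia} V^{,a}`. The quadratic and the constant equation hold
identically for the family with `ψ = 0`, so such a function is a first integral as soon as its
tensors are conformal Killing and the linear equation holds (`isExactQFI_familyQFI`); for the three
types the latter is a telescoping sum.

Conversely, let the linear coefficient of a first integral be `∑ g_i' L_{ia}`. The tensor
`K_{ab} + ∑ g_i L_{i(a;b)}` has time derivative `ψ γ_{ab}`, so its trace-free part is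
time-independent, and `1/n` times its trace is an antiderivative `φ` of `ψ`. As the energy is conserved,
subtracting `φ` times the constraint leaves a first integral (`CoeffEquations.sub_shell`), which is
a member of the family (`IsExactQFI.exists_familyQFI`). For `g_i` the functions `t^{p+1}/(p+1)` and
`e^{λt}`, which together with `1` are linearly independent (`polynomial_exp_independent`), the
remaining two equations split into the conditions defining the types, the odd powers in the linear
coefficient giving type 1 and the even powers type 2.

Independence of the types is linear independence of the functions of time once more: the part of
degree one in `v` of a multiple of the constraint vanishes, so the covector fields of type 2 and 3
in a vanishing sum vanish, and with them these integrals; the integral of type 1 is what remains.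
-/

open scoped ContDiff

noncomputable section


/-! ### Partial derivatives and smooth fields -/

section PartialDerivatives

variable {n : ℕ} {U : Set (Coord n)} {q : Coord n}

lemma pd_congr {f g : Coord n → ℝ} (hU : IsOpen U) (hq : q ∈ U) (h : ∀ x ∈ U, f x = g x)
    (a : Fin n) : pd a f q = pd a g q := by
  unfold pd
  rw [Filter.EventuallyEq.fderiv_eq (Filter.eventuallyEq_of_mem (hU.mem_nhds hq) h)]

lemma pd_zero (a : Fin n) : pd a (fun _ => (0 : ℝ)) q = 0 := by simp [pd]

lemma pd_add {f g : Coord n → ℝ} (hf : DifferentiableAt ℝ f q) (hg : DifferentiableAt ℝ g q)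
    (a : Fin n) : pd a (fun x => f x + g x) q = pd a f q + pd a g q := by
  simp [pd, fderiv_fun_add hf hg]

lemma pd_sub {f g : Coord n → ℝ} (hf : DifferentiableAt ℝ f q) (hg : DifferentiableAt ℝ g q)
    (a : Fin n) : pd a (fun x => f x - g x) q = pd a f q - pd a g q := by
  simp [pd, fderiv_fun_sub hf hg]

lemma pd_const_mul {f : Coord n → ℝ} (hf : DifferentiableAt ℝ f q) (c : ℝ) (a : Fin n) :
    pd a (fun x => c * f x) q = c * pd a f q := by
  simp [pd, fderiv_const_mul hf]

lemma pd_mul {f g : Coord n → ℝ} (hf : DifferentiableAt ℝ f q) (hg : DifferentiableAt ℝ g q)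
    (a : Fin n) : pd a (fun x => f x * g x) q = pd a f q * g q + f q * pd a g q := by
  simp only [pd, fderiv_fun_mul hf hg, add_apply,
    smul_apply, smul_eq_mul]
  ring

lemma pd_sum {ι : Type*} {s : Finset ι} {f : ι → Coord n → ℝ}
    (hf : ∀ i ∈ s, DifferentiableAt ℝ (f i) q) (a : Fin n) :
    pd a (fun x => ∑ i ∈ s, f i x) q = ∑ i ∈ s, pd a (f i) q := by
  simp [pd, fderiv_fun_sum hf]

/-- The directional derivative is the contraction of the partial derivatives. -/
lemma fderiv_apply_eq_sum_pd (f : Coord n → ℝ) (q v : Coord n) :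
    fderiv ℝ f q v = ∑ a, pd a f q * v a := by
  conv_lhs => rw [← Finset.univ_sum_single v]
  rw [map_sum]
  refine Finset.sum_congr rfl fun a _ => ?_
  have : Pi.single a (v a) = v a • (Pi.single a 1 : Coord n) := by
    rw [← Pi.single_smul]; simp
  rw [this, map_smul, pd, smul_eq_mul, mul_comm]

lemma contDiffOn_pd {f : Coord n → ℝ} (hU : IsOpen U) (hf : ContDiffOn ℝ ∞ f U) (a : Fin n) :
    ContDiffOn ℝ ∞ (pd a f) U :=
  (hf.fderiv_of_isOpen hU (by simp)).clm_apply contDiffOn_const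

end PartialDerivatives

namespace ConservativeSystem

variable {n : ℕ} (S : ConservativeSystem n)

variable {S} in
lemma _root_.ContDiffOn.differentiableAt_coord {f : Coord n → ℝ} (hf : ContDiffOn ℝ ∞ f S.U)
    {q : Coord n} (hq : q ∈ S.U) : DifferentiableAt ℝ f q :=
  (hf.contDiffAt (S.isOpen_U.mem_nhds hq)).differentiableAt (by simp)

/-- Cramer's rule exhibits the inverse metric as a smooth field. -/
lemma inv_smooth (a b : Fin n) : ContDiffOn ℝ ∞ (fun q => (S.γ q)⁻¹ a b) S.U := by
  have hdet : ∀ M : Coord n → Matrix (Fin n) (Fin n) ℝ,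
      (∀ a b, ContDiffOn ℝ ∞ (fun q => M q a b) S.U) →
      ContDiffOn ℝ ∞ (fun q => (M q).det) S.U := by
    intro M hM
    simp only [Matrix.det_apply']
    exact ContDiffOn.sum fun σ _ => contDiffOn_const.mul (contDiffOn_prod fun i _ => hM _ _)
  simp only [Matrix.inv_def, Matrix.smul_apply, smul_eq_mul, Ring.inverse_eq_inv',
    Matrix.adjugate_apply]
  refine ContDiffOn.mul ((hdet _ S.γ_smooth).inv fun q hq => (S.γ_nondegenerate q hq).ne_zero)
    (hdet _ fun c d => ?_)
  by_cases h : c = b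
  · subst h; simpa using contDiffOn_const
  · simpa [Matrix.updateRow_ne h] using S.γ_smooth c d

lemma Γ_smooth (a b c : Fin n) : ContDiffOn ℝ ∞ (fun q => S.Γ q a b c) S.U := by
  unfold Γ
  refine contDiffOn_const.mul (ContDiffOn.sum fun d _ => (S.inv_smooth a d).mul ?_)
  exact ((contDiffOn_pd S.isOpen_U (S.γ_smooth d c) b).add
    (contDiffOn_pd S.isOpen_U (S.γ_smooth d b) c)).sub
    (contDiffOn_pd S.isOpen_U (S.γ_smooth b c) d)

lemma gradV_smooth (a : Fin n) : ContDiffOn ℝ ∞ (fun q => S.gradV q a) S.U :=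
  ContDiffOn.sum fun b _ => (S.inv_smooth a b).mul (contDiffOn_pd S.isOpen_U S.V_smooth b)

variable {S}

lemma SmoothCovector.contrV {L : CovectorField n} (hL : S.SmoothCovector L) :
    S.SmoothScalar (S.contrV L) :=
  ContDiffOn.sum fun a _ => (hL a).mul (S.gradV_smooth a)

lemma SmoothCovector.covDeriv {L : CovectorField n} (hL : S.SmoothCovector L) (a b : Fin n) :
    S.SmoothScalar (fun q => S.covDeriv L q a b) :=
  (contDiffOn_pd S.isOpen_U (hL a) b).sub
    (ContDiffOn.sum fun c _ => (S.Γ_smooth c a b).mul (hL c))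

lemma SmoothCovector.symCov {L : CovectorField n} (hL : S.SmoothCovector L) :
    S.SmoothSymTensor (S.symCov L) := by
  refine ⟨fun a b => contDiffOn_const.mul ((hL.covDeriv a b).add (hL.covDeriv b a)), ?_⟩
  intro q _ a b
  simp only [ConservativeSystem.symCov, add_comm]

lemma SmoothCovector.const_mul {L : CovectorField n} (hL : S.SmoothCovector L) (c : ℝ) :
    S.SmoothCovector (fun q a => c * L q a) := fun a => contDiffOn_const.mul (hL a)

/-! ### Linearity and locality of the covariant derivatives -/

lemma symCov_congr {L L' : CovectorField n} (h : ∀ q ∈ S.U, ∀ a, L q a = L' q a) {q : Coord n}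
    (hq : q ∈ S.U) (a b : Fin n) : S.symCov L q a b = S.symCov L' q a b := by
  simp only [symCov, covDeriv, pd_congr S.isOpen_U hq (fun x hx => h x hx _), h q hq]

lemma covDeriv_sum {ι : Type*} {s : Finset ι} {L : ι → CovectorField n} (c : ι → ℝ)
    (hL : ∀ i ∈ s, S.SmoothCovector (L i)) {q : Coord n} (hq : q ∈ S.U) (a b : Fin n) :
    S.covDeriv (fun x d => ∑ i ∈ s, c i * L i x d) q a b =
      ∑ i ∈ s, c i * S.covDeriv (L i) q a b := by
  have hd : ∀ a, ∀ i ∈ s, DifferentiableAt ℝ (fun x => L i x a) q :=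
    fun a i hi => (hL i hi a).differentiableAt_coord hq
  simp only [covDeriv]
  rw [pd_sum fun i hi => (hd a i hi).const_mul _]
  simp only [mul_sub, Finset.sum_sub_distrib, Finset.mul_sum]
  rw [Finset.sum_congr rfl fun i hi => pd_const_mul (hd a i hi) (c i) b]
  rw [Finset.sum_comm]
  simp only [mul_left_comm]

lemma symCov_sum {ι : Type*} {s : Finset ι} {L : ι → CovectorField n} (c : ι → ℝ)
    (hL : ∀ i ∈ s, S.SmoothCovector (L i)) {q : Coord n} (hq : q ∈ S.U) (a b : Fin n) :
    S.symCov (fun x d => ∑ i ∈ s, c i * L i x d) q a b =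
      ∑ i ∈ s, c i * S.symCov (L i) q a b := by
  simp only [symCov]
  rw [covDeriv_sum c hL hq, covDeriv_sum c hL hq, ← Finset.sum_add_distrib, Finset.mul_sum]
  exact Finset.sum_congr rfl fun i _ => by ring

lemma symCov_zero (q : Coord n) (a b : Fin n) : S.symCov (fun _ _ => 0) q a b = 0 := by
  simp [symCov, covDeriv, pd_zero]

lemma contrV_zero (q : Coord n) : S.contrV (fun _ _ => 0) q = 0 := by simp [contrV]

lemma contrV_congr {L L' : CovectorField n} {q : Coord n} (h : ∀ a, L q a = L' q a) :
    S.contrV L q = S.contrV L' q := by simp only [contrV, h]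

lemma contrV_sum {ι : Type*} {s : Finset ι} (L : ι → CovectorField n) (c : ι → ℝ) (q : Coord n) :
    S.contrV (fun x d => ∑ i ∈ s, c i * L i x d) q = ∑ i ∈ s, c i * S.contrV (L i) q := by
  simp only [contrV, Finset.sum_mul, Finset.mul_sum]
  rw [Finset.sum_comm]
  simp only [mul_assoc]

variable (S) in
/-- The cyclic sum `K_{ab;c} + K_{bc;a} + K_{ca;b}`; for symmetric `K` it is `3 K_{(ab;c)}`. -/
def cycCov (K : TensorField2 n) (q : Coord n) (a b c : Fin n) : ℝ :=
  S.covDeriv2 K q a b c + S.covDeriv2 K q b c a + S.covDeriv2 K q c a b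

lemma covDeriv2_congr {K K' : TensorField2 n} (h : ∀ q ∈ S.U, ∀ a b, K q a b = K' q a b)
    {q : Coord n} (hq : q ∈ S.U) (a b c : Fin n) :
    S.covDeriv2 K q a b c = S.covDeriv2 K' q a b c := by
  simp only [covDeriv2, pd_congr S.isOpen_U hq (fun x hx => h x hx _ _), h q hq]

lemma covDeriv2_sub {K K' : TensorField2 n} (hK : S.SmoothSymTensor K)
    (hK' : S.SmoothSymTensor K') {q : Coord n} (hq : q ∈ S.U) (a b c : Fin n) :
    S.covDeriv2 (fun x d e => K x d e - K' x d e) q a b c =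
      S.covDeriv2 K q a b c - S.covDeriv2 K' q a b c := by
  simp only [covDeriv2]
  rw [pd_sub ((hK.1 a b).differentiableAt_coord hq) ((hK'.1 a b).differentiableAt_coord hq)]
  simp only [mul_sub, Finset.sum_sub_distrib]
  ring

lemma covDeriv2_sum {ι : Type*} {s : Finset ι} {K : ι → TensorField2 n} (w : ι → ℝ)
    (hK : ∀ i ∈ s, S.SmoothSymTensor (K i)) {q : Coord n} (hq : q ∈ S.U) (a b c : Fin n) :
    S.covDeriv2 (fun x d e => ∑ i ∈ s, w i * K i x d e) q a b c =
      ∑ i ∈ s, w i * S.covDeriv2 (K i) q a b c := by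
  have hd : ∀ i ∈ s, DifferentiableAt ℝ (fun x => K i x a b) q :=
    fun i hi => ((hK i hi).1 a b).differentiableAt_coord hq
  simp only [covDeriv2]
  rw [pd_sum fun i hi => (hd i hi).const_mul _]
  simp only [mul_sub, Finset.sum_sub_distrib, Finset.mul_sum]
  rw [Finset.sum_congr rfl fun i hi => pd_const_mul (hd i hi) (w i) c]
  congr 1
  · congr 1
    rw [Finset.sum_comm]
    simp only [mul_left_comm]
  · rw [Finset.sum_comm]
    simp only [mul_left_comm]

lemma SmoothSymTensor.sum {ι : Type*} {s : Finset ι} {K : ι → TensorField2 n} (w : ι → ℝ)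
    (hK : ∀ i ∈ s, S.SmoothSymTensor (K i)) :
    S.SmoothSymTensor (fun x d e => ∑ i ∈ s, w i * K i x d e) :=
  ⟨fun a b => ContDiffOn.sum fun i hi => contDiffOn_const.mul ((hK i hi).1 a b),
    fun q hq a b => Finset.sum_congr rfl fun i hi => by rw [(hK i hi).2 q hq a b]⟩

lemma SmoothSymTensor.sub {K K' : TensorField2 n} (hK : S.SmoothSymTensor K)
    (hK' : S.SmoothSymTensor K') : S.SmoothSymTensor (fun x d e => K x d e - K' x d e) :=
  ⟨fun a b => (hK.1 a b).sub (hK'.1 a b), fun q hq a b => by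
    simp only [hK.2 q hq a b, hK'.2 q hq a b]⟩

lemma cycCov_sub_sum {ι : Type*} {s : Finset ι} {C : TensorField2 n} {K : ι → TensorField2 n}
    (w : ι → ℝ) (hC : S.SmoothSymTensor C) (hK : ∀ i ∈ s, S.SmoothSymTensor (K i))
    {q : Coord n} (hq : q ∈ S.U) (a b c : Fin n) :
    S.cycCov (fun x d e => C x d e - ∑ i ∈ s, w i * K i x d e) q a b c =
      S.cycCov C q a b c - ∑ i ∈ s, w i * S.cycCov (K i) q a b c := by
  simp only [cycCov, covDeriv2_sub hC (SmoothSymTensor.sum w hK) hq, covDeriv2_sum w hK hq,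
    mul_add, Finset.sum_add_distrib]
  ring

end ConservativeSystem


/-! ### Polynomial identities in the velocities -/

section Polarization

variable {n : ℕ}

lemma linearForm_eq_zero {T : Fin n → ℝ} (h : ∀ v : Coord n, ∑ a, T a * v a = 0) (a : Fin n) :
    T a = 0 := by
  simpa [Pi.single_apply] using h (Pi.single a 1)

lemma quadraticForm_eq_zero {T : Fin n → Fin n → ℝ} (hT : ∀ a b, T a b = T b a)
    (h : ∀ v : Coord n, ∑ a, ∑ b, T a b * v a * v b = 0) (a b : Fin n) : T a b = 0 := by
  let B : Coord n → Coord n → ℝ := fun x y => ∑ a, ∑ b, T a b * x a * y b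
  have add_left : ∀ x x' y, B (x + x') y = B x y + B x' y := fun x x' y => by
    simp only [B, Pi.add_apply, mul_add, add_mul, Finset.sum_add_distrib]
  have add_right : ∀ x y y', B x (y + y') = B x y + B x y' := fun x y y' => by
    simp only [B, Pi.add_apply, mul_add, Finset.sum_add_distrib]
  have single : ∀ a b, B (Pi.single a 1) (Pi.single b 1) = T a b := fun a b => by
    simp [B, Pi.single_apply]
  have hB : ∀ v, B v v = 0 := h
  have h1 := hB (Pi.single a 1 + Pi.single b 1)
  simp only [add_left, add_right, hB, single] at h1
  linarith [hT a b]

/-- Polarization of a vanishing cubic form whose coefficients are symmetric in two indices. -/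
lemma cubicForm_eq_zero {T : Fin n → Fin n → Fin n → ℝ} (hT : ∀ a b c, T a b c = T b a c)
    (h : ∀ v : Coord n, ∑ a, ∑ b, ∑ c, T a b c * v a * v b * v c = 0) (a b c : Fin n) :
    T a b c + T b c a + T c a b = 0 := by
  let B : Coord n → Coord n → Coord n → ℝ :=
    fun x y z => ∑ a, ∑ b, ∑ c, T a b c * x a * y b * z c
  have add1 : ∀ x x' y z, B (x + x') y z = B x y z + B x' y z := fun x x' y z => by
    simp only [B, Pi.add_apply, mul_add, add_mul, Finset.sum_add_distrib]
  have add2 : ∀ x y y' z, B x (y + y') z = B x y z + B x y' z := fun x y y' z => by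
    simp only [B, Pi.add_apply, mul_add, add_mul, Finset.sum_add_distrib]
  have add3 : ∀ x y z z', B x y (z + z') = B x y z + B x y z' := fun x y z z' => by
    simp only [B, Pi.add_apply, mul_add, Finset.sum_add_distrib]
  have single : ∀ a b c, B (Pi.single a 1) (Pi.single b 1) (Pi.single c 1) = T a b c :=
    fun a b c => by simp [B, Pi.single_apply]
  have hB : ∀ v, B v v v = 0 := h
  have h3 := hB (Pi.single a 1 + Pi.single b 1 + Pi.single c 1)
  have hab := hB (Pi.single a 1 + Pi.single b 1)
  have hac := hB (Pi.single a 1 + Pi.single c 1)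
  have hbc := hB (Pi.single b 1 + Pi.single c 1)
  have ha := hB (Pi.single a 1)
  have hb := hB (Pi.single b 1)
  have hc := hB (Pi.single c 1)
  simp only [add1, add2, add3, single] at h3 hab hac hbc ha hb hc
  linarith [hT a b c, hT b c a, hT c a b]

/-- A polynomial of degree three in the velocities vanishes only if its homogeneous parts do. -/
lemma cubicPolynomial_parts_eq_zero {T₃ : Fin n → Fin n → Fin n → ℝ} {T₂ : Fin n → Fin n → ℝ}
    {T₁ : Fin n → ℝ} {T₀ : ℝ}
    (h : ∀ v : Coord n, (∑ a, ∑ b, ∑ c, T₃ a b c * v a * v b * v c) +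
      (∑ a, ∑ b, T₂ a b * v a * v b) + (∑ a, T₁ a * v a) + T₀ = 0) :
    (∀ v : Coord n, ∑ a, ∑ b, ∑ c, T₃ a b c * v a * v b * v c = 0) ∧
    (∀ v : Coord n, ∑ a, ∑ b, T₂ a b * v a * v b = 0) ∧
    (∀ v : Coord n, ∑ a, T₁ a * v a = 0) ∧ T₀ = 0 := by
  have key : ∀ (v : Coord n) (s : ℝ), s ^ 3 * (∑ a, ∑ b, ∑ c, T₃ a b c * v a * v b * v c) +
      s ^ 2 * (∑ a, ∑ b, T₂ a b * v a * v b) + s * (∑ a, T₁ a * v a) + T₀ = 0 := by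
    intro v s
    rw [← h (s • v)]
    simp only [Finset.mul_sum, Pi.smul_apply, smul_eq_mul]
    congr 1; congr 1; congr 1
    · refine Finset.sum_congr rfl fun a _ => Finset.sum_congr rfl fun b _ =>
        Finset.sum_congr rfl fun c _ => by ring
    · refine Finset.sum_congr rfl fun a _ => Finset.sum_congr rfl fun b _ => by ring
    · refine Finset.sum_congr rfl fun a _ => by ring
  refine ⟨fun v => ?_, fun v => ?_, fun v => ?_, ?_⟩
  · linarith [key v 0, key v 1, key v (-1), key v 2]
  · linarith [key v 0, key v 1, key v (-1), key v 2]
  · linarith [key v 0, key v 1, key v (-1), key v 2]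
  · linarith [key 0 0]

end Polarization

namespace ConservativeSystem

variable {n : ℕ} {S : ConservativeSystem n} {q : Coord n}

/-! ### Traces and metric compatibility -/

lemma γ_comm (hq : q ∈ S.U) (a b : Fin n) : S.γ q a b = S.γ q b a := (S.γ_symm q hq).apply b a

/-- Raising and then lowering an index changes nothing. -/
lemma sum_γ_inv (hq : q ∈ S.U) (w : Fin n → ℝ) (b : Fin n) :
    ∑ d, S.γ q b d * ∑ e, (S.γ q)⁻¹ d e * w e = w b := by
  have h : (S.γ q).mulVec ((S.γ q)⁻¹.mulVec w) = w := by
    rw [Matrix.mulVec_mulVec, Matrix.mul_nonsing_inv _ (S.γ_nondegenerate q hq),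
      Matrix.one_mulVec]
  exact congrFun h b

lemma sum_inv_γ (hq : q ∈ S.U) (a b : Fin n) :
    ∑ d, (S.γ q)⁻¹ a d * S.γ q d b = if a = b then 1 else 0 := by
  have h := congrFun (congrFun (Matrix.nonsing_inv_mul _ (S.γ_nondegenerate q hq)) a) b
  rwa [Matrix.mul_apply, Matrix.one_apply] at h

lemma γ_contr_gradV (hq : q ∈ S.U) (a : Fin n) : ∑ b, S.γ q a b * S.gradV q b = pd a S.V q :=
  sum_γ_inv hq (fun b => pd b S.V q) a

lemma inv_comm (hq : q ∈ S.U) (a b : Fin n) : (S.γ q)⁻¹ a b = (S.γ q)⁻¹ b a := by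
  have h : ((S.γ q)⁻¹).transpose = (S.γ q)⁻¹ := by rw [Matrix.transpose_nonsing_inv, S.γ_symm q hq]
  exact congrFun (congrFun h b) a

lemma lowered_Γ (hq : q ∈ S.U) (a b c : Fin n) :
    ∑ d, S.γ q b d * S.Γ q d a c = (1 / 2) * (pd a (fun x => S.γ x b c) q +
      pd c (fun x => S.γ x b a) q - pd b (fun x => S.γ x a c) q) := by
  rw [← sum_γ_inv hq (fun e => pd a (fun x => S.γ x e c) q + pd c (fun x => S.γ x e a) q -
    pd e (fun x => S.γ x a c) q) b, Finset.mul_sum]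
  refine Finset.sum_congr rfl fun d _ => ?_
  rw [Γ]; ring

lemma pd_γ_comm (hq : q ∈ S.U) (a b c : Fin n) :
    pd c (fun x => S.γ x a b) q = pd c (fun x => S.γ x b a) q :=
  pd_congr S.isOpen_U hq (fun _ hx => γ_comm hx a b) c

/-- The metric is covariantly constant. -/
lemma covDeriv2_γ (hq : q ∈ S.U) (a b c : Fin n) :
    S.covDeriv2 (fun x d e => S.γ x d e) q a b c = 0 := by
  have h1 : ∑ d, S.Γ q d a c * S.γ q d b = ∑ d, S.γ q b d * S.Γ q d a c :=
    Finset.sum_congr rfl fun d _ => by rw [γ_comm hq d b, mul_comm]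
  have h2 : ∑ d, S.Γ q d b c * S.γ q a d = ∑ d, S.γ q a d * S.Γ q d b c :=
    Finset.sum_congr rfl fun d _ => by rw [mul_comm]
  simp only [covDeriv2]
  rw [h1, h2, lowered_Γ hq, lowered_Γ hq, pd_γ_comm hq b c a, pd_γ_comm hq a c b,
    pd_γ_comm hq b a c, pd_γ_comm hq c b a, pd_γ_comm hq c a b]
  ring

lemma covDeriv2_mul_γ {φ : Coord n → ℝ} (hφ : S.SmoothScalar φ) (hq : q ∈ S.U) (a b c : Fin n) :
    S.covDeriv2 (fun x d e => φ x * S.γ x d e) q a b c = pd c φ q * S.γ q a b := by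
  have h := covDeriv2_γ hq a b c
  simp only [covDeriv2] at h ⊢
  rw [pd_mul (hφ.differentiableAt_coord hq) ((S.γ_smooth a b).differentiableAt_coord hq)]
  simp only [mul_left_comm _ (φ q), ← Finset.mul_sum]
  linear_combination φ q * h

variable (S) in
/-- The trace `γ^{ab} T_{ab}`. -/
def trace2 (q : Coord n) (T : Fin n → Fin n → ℝ) : ℝ := ∑ a, ∑ b, (S.γ q)⁻¹ a b * T a b

lemma trace2_mul_γ (hq : q ∈ S.U) (ψ : ℝ) :
    S.trace2 q (fun a b => ψ * S.γ q a b) = n * ψ := by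
  have : ∀ a, ∑ b, (S.γ q)⁻¹ a b * (ψ * S.γ q a b) = ψ := fun a => by
    have h := sum_inv_γ hq a a
    simp only [if_true] at h
    calc _ = ψ * ∑ b, (S.γ q)⁻¹ a b * S.γ q b a := by
          rw [Finset.mul_sum]
          exact Finset.sum_congr rfl fun b _ => by rw [γ_comm hq a b]; ring
      _ = ψ := by rw [h, mul_one]
  simp [trace2, this]

lemma trace2_sum {ι : Type*} (s : Finset ι) (w : ι → ℝ) (T : ι → Fin n → Fin n → ℝ) :
    S.trace2 q (fun a b => ∑ i ∈ s, w i * T i a b) = ∑ i ∈ s, w i * S.trace2 q (T i) := by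
  simp only [trace2, Finset.mul_sum]
  simp only [Finset.sum_comm (s := s), mul_left_comm]

variable (S) in
/-- The covector `γ^{bc} T_{abc} / (n + 2)`, which recovers `X_a` from
`X_a γ_{bc} + X_b γ_{ca} + X_c γ_{ab}`. -/
def assocVector (q : Coord n) (T : Fin n → Fin n → Fin n → ℝ) (a : Fin n) : ℝ :=
  (1 / (n + 2 : ℝ)) * S.trace2 q (T a)

variable (S) in
/-- The totally symmetric tensor `X_a γ_{bc} + X_b γ_{ca} + X_c γ_{ab}`. -/
def cycMetric (q : Coord n) (X : Fin n → ℝ) (a b c : Fin n) : ℝ :=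
  X a * S.γ q b c + X b * S.γ q c a + X c * S.γ q a b

lemma assocVector_cycMetric (hq : q ∈ S.U) (X : Fin n → ℝ) :
    S.assocVector q (S.cycMetric q X) = X := by
  funext a
  have h1 := trace2_mul_γ hq (X a)
  have h2 : ∑ b, ∑ c, (S.γ q)⁻¹ b c * (X b * S.γ q c a) = X a := by
    have : ∀ b, ∑ c, (S.γ q)⁻¹ b c * (X b * S.γ q c a) = X b * if b = a then 1 else 0 := by
      intro b
      rw [← sum_inv_γ hq, Finset.mul_sum]
      exact Finset.sum_congr rfl fun c _ => by ring
    simp [this]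
  have h3 : ∑ b, ∑ c, (S.γ q)⁻¹ b c * (X c * S.γ q a b) = X a := by
    rw [Finset.sum_comm, ← h2]
    refine Finset.sum_congr rfl fun b _ => Finset.sum_congr rfl fun c _ => ?_
    rw [inv_comm hq c b, γ_comm hq a c]
  have hn : (n + 2 : ℝ) ≠ 0 := by positivity
  simp only [trace2] at h1
  simp only [assocVector, trace2, cycMetric, mul_add, Finset.sum_add_distrib, h1, h2, h3]
  field_simp
  ring

lemma assocVector_sum {ι : Type*} (s : Finset ι) (w : ι → ℝ)
    (T : ι → Fin n → Fin n → Fin n → ℝ) (a : Fin n) :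
    S.assocVector q (fun a b c => ∑ i ∈ s, w i * T i a b c) a =
      ∑ i ∈ s, w i * S.assocVector q (T i) a := by
  simp only [assocVector, trace2_sum, Finset.mul_sum]
  exact Finset.sum_congr rfl fun i _ => by ring

lemma trace2_sub (T T' : Fin n → Fin n → ℝ) :
    S.trace2 q (fun a b => T a b - T' a b) = S.trace2 q T - S.trace2 q T' := by
  simp only [trace2, mul_sub, Finset.sum_sub_distrib]

lemma assocVector_sub (T T' : Fin n → Fin n → Fin n → ℝ) (a : Fin n) :
    S.assocVector q (fun a b c => T a b c - T' a b c) a =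
      S.assocVector q T a - S.assocVector q T' a := by
  simp only [assocVector, trace2_sub, mul_sub]

lemma cycMetric_sub_sum {ι : Type*} (s : Finset ι) (w : ι → ℝ) (X : Fin n → ℝ)
    (Y : ι → Fin n → ℝ) (a b c : Fin n) :
    S.cycMetric q (fun a => X a - ∑ i ∈ s, w i * Y i a) a b c =
      S.cycMetric q X a b c - ∑ i ∈ s, w i * S.cycMetric q (Y i) a b c := by
  simp only [cycMetric, sub_mul, mul_add, Finset.sum_add_distrib, Finset.sum_mul, mul_assoc]
  ring

end ConservativeSystem


namespace ConservativeSystem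

variable {n : ℕ} {S : ConservativeSystem n} {q : Coord n}

/-! ### The total derivative of a quadratic function -/

variable (S) in
/-- A smooth time-dependent scalar on the coordinate domain. -/
def SmoothTimeScalar (f : ℝ → Coord n → ℝ) : Prop :=
  ContDiffOn ℝ ∞ (fun p : ℝ × Coord n => f p.1 p.2) (Set.univ ×ˢ S.U)

/-- The smoothness and symmetry required of the coefficients of a quadratic first integral. -/
structure IsRegular (S : ConservativeSystem n) (K : QuadraticFunction n) : Prop where
  quad : ∀ a b, S.SmoothTimeScalar fun t q => K.quad t q a b
  lin : ∀ a, S.SmoothTimeScalar fun t q => K.lin t q a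
  scal : S.SmoothTimeScalar K.scal
  symm : ∀ t, ∀ q ∈ S.U, ∀ a b, K.quad t q a b = K.quad t q b a

lemma SmoothTimeScalar.differentiableAt {f : ℝ → Coord n → ℝ} (hf : S.SmoothTimeScalar f)
    (t : ℝ) (hq : q ∈ S.U) : DifferentiableAt ℝ (fun p : ℝ × Coord n => f p.1 p.2) (t, q) :=
  (hf.contDiffAt ((isOpen_univ.prod S.isOpen_U).mem_nhds ⟨Set.mem_univ _, hq⟩)).differentiableAt
    (by simp)

lemma SmoothTimeScalar.at_time {f : ℝ → Coord n → ℝ} (hf : S.SmoothTimeScalar f) (t : ℝ) :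
    S.SmoothScalar (f t) :=
  ContDiffOn.comp (t := Set.univ ×ˢ S.U) hf (contDiffOn_const.prodMk contDiffOn_id)
    fun _ hx => ⟨Set.mem_univ _, hx⟩

lemma SmoothTimeScalar.hasDerivAt_time {f : ℝ → Coord n → ℝ} (hf : S.SmoothTimeScalar f)
    (t : ℝ) (hq : q ∈ S.U) : HasDerivAt (fun s => f s q) (deriv (fun s => f s q) t) t :=
  (DifferentiableAt.comp t (g := fun p : ℝ × Coord n => f p.1 p.2) (f := fun s => (s, q))
    (hf.differentiableAt t hq)
    (differentiableAt_id.prodMk (differentiableAt_const q))).hasDerivAt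

/-- The derivative of a time-dependent scalar along a line in `ℝ × ℝⁿ` of velocity `(1, v)`. -/
lemma SmoothTimeScalar.hasDerivAt_line {f : ℝ → Coord n → ℝ} (hf : S.SmoothTimeScalar f)
    (t : ℝ) (hq : q ∈ S.U) (v : Coord n) :
    HasDerivAt (fun s : ℝ => f (t + s) (q + s • v))
      (deriv (fun s => f s q) t + ∑ c, pd c (f t) q * v c) 0 := by
  set F := fun p : ℝ × Coord n => f p.1 p.2
  have hF := (hf.differentiableAt t hq).hasFDerivAt
  have hline : HasDerivAt (fun s : ℝ => (t + s, q + s • v)) ((1 : ℝ), v) 0 := by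
    refine ((hasDerivAt_id (0 : ℝ)).const_add t).prodMk ?_
    simpa using ((hasDerivAt_id (0 : ℝ)).smul_const v).const_add q
  have h := HasFDerivAt.comp_hasDerivAt (0 : ℝ) (l := F) (l' := fderiv ℝ F (t, q))
    (by simpa using hF) hline
  have ht : deriv (fun s => f s q) t = fderiv ℝ F (t, q) (1, 0) :=
    (HasFDerivAt.comp_hasDerivAt t (l := F) hF
      ((hasDerivAt_id t).prodMk (hasDerivAt_const t q))).deriv
  have hx : fderiv ℝ (f t) q = (fderiv ℝ F (t, q)).comp (ContinuousLinearMap.inr ℝ ℝ (Coord n)) :=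
    (HasFDerivAt.comp q (g := F) hF (hasFDerivAt_prodMk_right t q)).fderiv
  have hsum : fderiv ℝ F (t, q) (1, v) =
      deriv (fun s => f s q) t + ∑ c, pd c (f t) q * v c := by
    rw [ht, ← fderiv_apply_eq_sum_pd, hx]
    simp [← map_add]
  rw [← hsum]
  exact h

lemma IsRegular.differentiableAt_eval {K : QuadraticFunction n} (hK : S.IsRegular K) (t : ℝ)
    (hq : q ∈ S.U) (v : Coord n) :
    DifferentiableAt ℝ (fun p : ℝ × Coord n × Coord n => K.eval p.1 p.2.1 p.2.2) (t, q, v) := by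
  have lift : ∀ f : ℝ → Coord n → ℝ, S.SmoothTimeScalar f →
      DifferentiableAt ℝ (fun p : ℝ × Coord n × Coord n => f p.1 p.2.1) (t, q, v) := by
    intro f hf
    exact DifferentiableAt.comp (t, q, v) (g := fun p : ℝ × Coord n => f p.1 p.2)
      (f := fun p : ℝ × Coord n × Coord n => (p.1, p.2.1)) (hf.differentiableAt t hq) (by fun_prop)
  have hv : ∀ a, DifferentiableAt ℝ (fun p : ℝ × Coord n × Coord n => p.2.2 a) (t, q, v) :=
    fun a => by fun_prop
  unfold QuadraticFunction.eval
  refine DifferentiableAt.add (DifferentiableAt.add ?_ ?_) (lift _ hK.scal)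
  · exact DifferentiableAt.fun_sum fun a _ => DifferentiableAt.fun_sum fun b _ =>
      ((lift _ (hK.quad a b)).mul (hv a)).mul (hv b)
  · exact DifferentiableAt.fun_sum fun a _ => (lift _ (hK.lin a)).mul (hv a)

/-- The total derivative by the product rule, before the equations of motion are expanded. -/
lemma totalDeriv_eq_aux {K : QuadraticFunction n} (hK : S.IsRegular K) (t : ℝ)
    (hq : q ∈ S.U) (v : Coord n) :
    S.totalDeriv K.eval t q v =
      (∑ a, ∑ b, (((deriv (fun s => K.quad s q a b) t +
          ∑ c, pd c (fun x => K.quad t x a b) q * v c) * v a +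
          K.quad t q a b * S.accel q v a) * v b +
          K.quad t q a b * v a * S.accel q v b)) +
      (∑ a, ((deriv (fun s => K.lin s q a) t + ∑ c, pd c (fun x => K.lin t x a) q * v c) * v a +
        K.lin t q a * S.accel q v a)) +
      (deriv (fun s => K.scal s q) t + ∑ c, pd c (K.scal t) q * v c) := by
  set w := S.accel q v
  have hline : HasDerivAt (fun s : ℝ => (t + s, q + s • v, v + s • w)) ((1 : ℝ), v, w) 0 := by
    refine ((hasDerivAt_id (0 : ℝ)).const_add t).prodMk (HasDerivAt.prodMk ?_ ?_)
    · simpa using ((hasDerivAt_id (0 : ℝ)).smul_const v).const_add q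
    · simpa using ((hasDerivAt_id (0 : ℝ)).smul_const w).const_add v
  have h1 := HasFDerivAt.comp_hasDerivAt (0 : ℝ)
    (l := fun p : ℝ × Coord n × Coord n => K.eval p.1 p.2.1 p.2.2)
    (by simpa using (hK.differentiableAt_eval t hq v).hasFDerivAt) hline
  have hv : ∀ a, HasDerivAt (fun s : ℝ => (v + s • w) a) (w a) 0 := fun a => by
    simpa using ((hasDerivAt_id (0 : ℝ)).mul_const (w a)).const_add (v a)
  have hquad : ∀ a ∈ Finset.univ, ∀ b ∈ Finset.univ, HasDerivAt
      (fun s : ℝ => K.quad (t + s) (q + s • v) a b * (v + s • w) a * (v + s • w) b) _ 0 :=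
    fun a _ b _ => (((hK.quad a b).hasDerivAt_line t hq v).mul (hv a)).mul (hv b)
  have hlin : ∀ a ∈ Finset.univ, HasDerivAt
      (fun s : ℝ => K.lin (t + s) (q + s • v) a * (v + s • w) a) _ 0 :=
    fun a _ => ((hK.lin a).hasDerivAt_line t hq v).mul (hv a)
  have h2 := (((HasDerivAt.fun_sum fun a ha => HasDerivAt.fun_sum (hquad a ha)).add
    (HasDerivAt.fun_sum hlin)).add (hK.scal.hasDerivAt_line t hq v))
  have h3 := h1.unique h2
  unfold totalDeriv
  rw [h3]
  simp

/-- The total derivative as a polynomial in the velocities. -/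
lemma totalDeriv_eq {K : QuadraticFunction n} (hK : S.IsRegular K) (t : ℝ)
    (hq : q ∈ S.U) (v : Coord n) :
    S.totalDeriv K.eval t q v =
      (∑ a, ∑ b, ∑ c, S.covDeriv2 (K.quad t) q a b c * v a * v b * v c) +
      (∑ a, ∑ b, (deriv (fun s => K.quad s q a b) t + S.symCov (K.lin t) q a b) * v a * v b) +
      (∑ a, (deriv (fun s => K.lin s q a) t + pd a (K.scal t) q -
        2 * ∑ b, K.quad t q a b * S.gradV q b) * v a) +
      (deriv (fun s => K.scal s q) t - S.contrV (K.lin t) q) := by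
  rw [totalDeriv_eq_aux hK t hq v]
  have hacc : ∀ a, S.accel q v a =
    -(∑ b, ∑ c, S.Γ q a b c * v b * v c) - S.gradV q a := fun a => rfl
  -- symmetrization is invisible in the quadratic form
  have hsym : ∑ a, ∑ b, S.symCov (K.lin t) q a b * v a * v b =
      ∑ a, ∑ b, S.covDeriv (K.lin t) q a b * v a * v b := by
    have hc : ∑ a, ∑ b, S.covDeriv (K.lin t) q b a * v a * v b =
        ∑ a, ∑ b, S.covDeriv (K.lin t) q a b * v a * v b := by
      rw [Finset.sum_comm]
      exact Finset.sum_congr rfl fun a _ => Finset.sum_congr rfl fun b _ => by ring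
    have : ∑ a, ∑ b, S.symCov (K.lin t) q a b * v a * v b = (1 / 2) *
        (∑ a, ∑ b, S.covDeriv (K.lin t) q a b * v a * v b +
          ∑ a, ∑ b, S.covDeriv (K.lin t) q b a * v a * v b) := by
      simp only [symCov, Finset.mul_sum, ← Finset.sum_add_distrib]
      exact Finset.sum_congr rfl fun a _ => Finset.sum_congr rfl fun b _ => by ring
    rw [this, hc]; ring
  have hcubic : ∑ a, ∑ b, ∑ c, S.covDeriv2 (K.quad t) q a b c * v a * v b * v c =
      (∑ a, ∑ b, (∑ c, pd c (fun x => K.quad t x a b) q * v c) * v a * v b) +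
      (∑ a, ∑ b, K.quad t q a b * (-(∑ c, ∑ d, S.Γ q a c d * v c * v d)) * v b) +
      (∑ a, ∑ b, K.quad t q a b * v a * (-(∑ c, ∑ d, S.Γ q b c d * v c * v d))) := by
    have e1 : (∑ a, ∑ b, K.quad t q a b * (-(∑ c, ∑ d, S.Γ q a c d * v c * v d)) * v b) =
        -∑ a, ∑ b, ∑ c, (∑ d, S.Γ q d a c * K.quad t q d b) * v a * v b * v c := by
      simp only [Finset.mul_sum, Finset.sum_mul, mul_neg, neg_mul, Finset.sum_neg_distrib]
      congr 1
      -- both sides are sums over the four indices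
      calc ∑ a, ∑ b, ∑ c, ∑ d, K.quad t q a b * (S.Γ q a c d * v c * v d) * v b
          = ∑ a, ∑ c, ∑ b, ∑ d, K.quad t q a b * (S.Γ q a c d * v c * v d) * v b :=
            Finset.sum_congr rfl fun a _ => Finset.sum_comm
        _ = ∑ c, ∑ a, ∑ b, ∑ d, K.quad t q a b * (S.Γ q a c d * v c * v d) * v b :=
            Finset.sum_comm
        _ = ∑ c, ∑ b, ∑ a, ∑ d, K.quad t q a b * (S.Γ q a c d * v c * v d) * v b :=
            Finset.sum_congr rfl fun c _ => Finset.sum_comm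
        _ = ∑ c, ∑ b, ∑ d, ∑ a, K.quad t q a b * (S.Γ q a c d * v c * v d) * v b :=
            Finset.sum_congr rfl fun c _ => Finset.sum_congr rfl fun b _ => Finset.sum_comm
        _ = _ := Finset.sum_congr rfl fun c _ => Finset.sum_congr rfl fun b _ =>
            Finset.sum_congr rfl fun d _ => Finset.sum_congr rfl fun a _ => by ring
    have e2 : (∑ a, ∑ b, K.quad t q a b * v a * (-(∑ c, ∑ d, S.Γ q b c d * v c * v d))) =
        -∑ a, ∑ b, ∑ c, (∑ d, S.Γ q d b c * K.quad t q a d) * v a * v b * v c := by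
      simp only [Finset.mul_sum, Finset.sum_mul, mul_neg, Finset.sum_neg_distrib]
      congr 1
      refine Finset.sum_congr rfl fun a _ => ?_
      calc ∑ b, ∑ c, ∑ d, K.quad t q a b * v a * (S.Γ q b c d * v c * v d)
          = ∑ c, ∑ b, ∑ d, K.quad t q a b * v a * (S.Γ q b c d * v c * v d) := Finset.sum_comm
        _ = ∑ c, ∑ d, ∑ b, K.quad t q a b * v a * (S.Γ q b c d * v c * v d) :=
            Finset.sum_congr rfl fun c _ => Finset.sum_comm
        _ = _ := Finset.sum_congr rfl fun c _ => Finset.sum_congr rfl fun d _ =>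
            Finset.sum_congr rfl fun b _ => by ring
    rw [e1, e2]
    simp only [covDeriv2, sub_mul, Finset.sum_sub_distrib, Finset.sum_mul]
    have e3 : ∀ a b, (∑ c, pd c (fun x => K.quad t x a b) q * v a * v b * v c) =
        ∑ c, pd c (fun x => K.quad t x a b) q * v c * v a * v b := fun a b =>
      Finset.sum_congr rfl fun c _ => by ring
    simp only [e3]
    ring
  have hlin : ∑ a, ∑ b, S.covDeriv (K.lin t) q a b * v a * v b =
      (∑ a, (∑ c, pd c (fun x => K.lin t x a) q * v c) * v a) +
      ∑ a, K.lin t q a * (-(∑ b, ∑ c, S.Γ q a b c * v b * v c)) := by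
    have e1 : ∑ a, K.lin t q a * (-(∑ b, ∑ c, S.Γ q a b c * v b * v c)) =
        -∑ a, ∑ b, (∑ c, S.Γ q c a b * K.lin t q c) * v a * v b := by
      simp only [Finset.mul_sum, Finset.sum_mul, mul_neg, Finset.sum_neg_distrib]
      congr 1
      calc ∑ a, ∑ b, ∑ c, K.lin t q a * (S.Γ q a b c * v b * v c)
          = ∑ b, ∑ a, ∑ c, K.lin t q a * (S.Γ q a b c * v b * v c) := Finset.sum_comm
        _ = ∑ b, ∑ c, ∑ a, K.lin t q a * (S.Γ q a b c * v b * v c) :=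
            Finset.sum_congr rfl fun c _ => Finset.sum_comm
        _ = _ := Finset.sum_congr rfl fun c _ => Finset.sum_congr rfl fun d _ =>
            Finset.sum_congr rfl fun b _ => by ring
    rw [e1]
    simp only [covDeriv, sub_mul, Finset.sum_sub_distrib, Finset.sum_mul]
    have e3 : ∀ a, (∑ c, pd c (fun x => K.lin t x a) q * v a * v c) =
        ∑ c, pd c (fun x => K.lin t x a) q * v c * v a := fun a =>
      Finset.sum_congr rfl fun c _ => by ring
    simp only [e3]
    ring
  have hforce : ∑ a, (2 * ∑ b, K.quad t q a b * S.gradV q b) * v a =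
      (∑ a, ∑ b, K.quad t q a b * S.gradV q a * v b) +
      ∑ a, ∑ b, K.quad t q a b * v a * S.gradV q b := by
    have e1 : (∑ a, ∑ b, K.quad t q a b * S.gradV q a * v b) =
        ∑ a, ∑ b, K.quad t q a b * v a * S.gradV q b := by
      rw [Finset.sum_comm]
      refine Finset.sum_congr rfl fun a _ => Finset.sum_congr rfl fun b _ => ?_
      rw [hK.symm t q hq b a]; ring
    rw [e1]
    simp only [← Finset.sum_add_distrib, Finset.mul_sum, Finset.sum_mul]
    exact Finset.sum_congr rfl fun a _ => Finset.sum_congr rfl fun b _ => by ring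
  simp only [add_mul, sub_mul, Finset.sum_add_distrib, Finset.sum_sub_distrib]
  rw [hsym, hcubic, hlin, hforce]
  simp only [hacc, mul_sub, sub_mul, Finset.sum_sub_distrib, contrV]
  ring

variable (S) in
/-- The equations which the homogeneous parts in the velocity of
`dI/dt = (ψ + X_c v^c) (γ_{ab} v^a v^b + 2 (V - E₀))` impose on the coefficients of `I`, in
descending degree. -/
structure CoeffEquations (E₀ : ℝ) (K : QuadraticFunction n) (ψ : ℝ) (X : Fin n → ℝ)
    (t : ℝ) (q : Coord n) : Prop where
  cubic : ∀ a b c, S.cycCov (K.quad t) q a b c = S.cycMetric q X a b c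
  quadratic : ∀ a b,
    deriv (fun s => K.quad s q a b) t + S.symCov (K.lin t) q a b = ψ * S.γ q a b
  linear : ∀ a, deriv (fun s => K.lin s q a) t + pd a (K.scal t) q -
    2 * ∑ b, K.quad t q a b * S.gradV q b = 2 * (S.V q - E₀) * X a
  constant : deriv (fun s => K.scal s q) t - S.contrV (K.lin t) q = 2 * (S.V q - E₀) * ψ

lemma covDeriv2_comm {K : TensorField2 n} (hK : ∀ q ∈ S.U, ∀ a b, K q a b = K q b a)
    (hq : q ∈ S.U) (a b c : Fin n) : S.covDeriv2 K q a b c = S.covDeriv2 K q b a c := by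
  simp only [covDeriv2]
  rw [pd_congr S.isOpen_U hq (fun x hx => hK x hx a b) c]
  simp only [hK q hq _ b, hK q hq a]
  ring

lemma symCov_comm (L : CovectorField n) (q : Coord n) (a b : Fin n) :
    S.symCov L q a b = S.symCov L q b a := by simp only [symCov, add_comm]

/-- The sum of a form over cyclic permutations of the indices is three times the form. -/
lemma sum_cyclic (T : Fin n → Fin n → Fin n → ℝ) (v : Coord n) :
    ∑ a, ∑ b, ∑ c, (T a b c + T b c a + T c a b) * v a * v b * v c =
      3 * ∑ a, ∑ b, ∑ c, T a b c * v a * v b * v c := by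
  have h1 : ∑ a, ∑ b, ∑ c, T b c a * v a * v b * v c =
      ∑ a, ∑ b, ∑ c, T a b c * v a * v b * v c := by
    rw [Finset.sum_comm]
    refine Finset.sum_congr rfl fun b _ => ?_
    rw [Finset.sum_comm]
    exact Finset.sum_congr rfl fun c _ => Finset.sum_congr rfl fun a _ => by ring
  have h2 : ∑ a, ∑ b, ∑ c, T c a b * v a * v b * v c =
      ∑ a, ∑ b, ∑ c, T a b c * v a * v b * v c := by
    rw [← h1]
    rw [Finset.sum_comm]
    refine Finset.sum_congr rfl fun b _ => ?_
    rw [Finset.sum_comm]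
    exact Finset.sum_congr rfl fun c _ => Finset.sum_congr rfl fun a _ => by ring
  simp only [add_mul, Finset.sum_add_distrib, h1, h2]
  ring

lemma mul_shell_eq (E₀ ψ : ℝ) (X : Fin n → ℝ) (q v : Coord n) :
    (ψ + ∑ c, X c * v c) * S.shell E₀ q v =
      (∑ a, ∑ b, ∑ c, S.γ q a b * X c * v a * v b * v c) +
      (∑ a, ∑ b, ψ * S.γ q a b * v a * v b) + (∑ a, 2 * (S.V q - E₀) * X a * v a) +
      2 * (S.V q - E₀) * ψ := by
  have h1 : ∑ a, ∑ b, ∑ c, S.γ q a b * X c * v a * v b * v c =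
      (∑ c, X c * v c) * ∑ a, ∑ b, S.γ q a b * v a * v b := by
    simp only [Finset.mul_sum, Finset.sum_mul]
    exact Finset.sum_congr rfl fun a _ => Finset.sum_congr rfl fun b _ =>
      Finset.sum_congr rfl fun c _ => by ring
  have h2 : ∑ a, ∑ b, ψ * S.γ q a b * v a * v b = ψ * ∑ a, ∑ b, S.γ q a b * v a * v b := by
    simp only [Finset.mul_sum, mul_assoc]
  have h3 : ∑ a, 2 * (S.V q - E₀) * X a * v a = 2 * (S.V q - E₀) * ∑ a, X a * v a := by
    simp only [Finset.mul_sum, mul_assoc]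
  rw [h1, h2, h3, shell]
  ring

lemma coeffEquations_iff {E₀ : ℝ} {K : QuadraticFunction n} (hK : S.IsRegular K) {ψ : ℝ}
    {X : Fin n → ℝ} {t : ℝ} (hq : q ∈ S.U) :
    S.CoeffEquations E₀ K ψ X t q ↔
      ∀ v, S.totalDeriv K.eval t q v = (ψ + ∑ c, X c * v c) * S.shell E₀ q v := by
  simp only [totalDeriv_eq hK t hq, mul_shell_eq]
  constructor
  · rintro ⟨h3, h2, h1, h0⟩ v
    have e3 : ∑ a, ∑ b, ∑ c, S.covDeriv2 (K.quad t) q a b c * v a * v b * v c =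
        ∑ a, ∑ b, ∑ c, S.γ q a b * X c * v a * v b * v c := by
      have e := sum_cyclic (fun a b c => S.covDeriv2 (K.quad t) q a b c) v
      have e' := sum_cyclic (fun a b c => S.γ q a b * X c) v
      have e'' : ∀ a b c, S.covDeriv2 (K.quad t) q a b c + S.covDeriv2 (K.quad t) q b c a +
          S.covDeriv2 (K.quad t) q c a b =
          S.γ q a b * X c + S.γ q b c * X a + S.γ q c a * X b := fun a b c => by
        have := h3 a b c
        simp only [cycCov, cycMetric] at this
        linarith
      simp only [e''] at e
      linarith
    simp only [e3, h2, h1, h0]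
  · intro h
    obtain ⟨h3, h2, h1, h0⟩ := cubicPolynomial_parts_eq_zero
      (T₃ := fun a b c => S.covDeriv2 (K.quad t) q a b c - S.γ q a b * X c)
      (T₂ := fun a b => deriv (fun s => K.quad s q a b) t + S.symCov (K.lin t) q a b -
        ψ * S.γ q a b)
      (T₁ := fun a => deriv (fun s => K.lin s q a) t + pd a (K.scal t) q -
        2 * ∑ b, K.quad t q a b * S.gradV q b - 2 * (S.V q - E₀) * X a)
      (T₀ := deriv (fun s => K.scal s q) t - S.contrV (K.lin t) q - 2 * (S.V q - E₀) * ψ)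
      (fun v => by
        have := h v
        simp only [sub_mul _ _ (v _), Finset.sum_sub_distrib] at this ⊢
        linarith)
    refine ⟨fun a b c => ?_, fun a b => ?_, fun a => ?_, ?_⟩
    · have := cubicForm_eq_zero (fun a b c => ?_) h3 a b c
      · simp only [cycCov, cycMetric]; linarith
      · rw [covDeriv2_comm (hK.symm t) hq a b c, γ_comm hq a b]
    · have := quadraticForm_eq_zero (fun a b => ?_) h2 a b
      · linarith
      · have e : (fun s => K.quad s q a b) = fun s => K.quad s q b a :=
          funext fun s => hK.symm s q hq a b
        rw [symCov_comm, γ_comm hq a b, e]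
    · linarith [linearForm_eq_zero h1 a]
    · linarith

lemma isExactQFI_iff {E₀ : ℝ} {K : QuadraticFunction n} :
    S.IsExactQFI E₀ K ↔ S.IsRegular K ∧ ∃ (ψ : ℝ → Coord n → ℝ) (X : ℝ → CovectorField n),
      ∀ t, ∀ q ∈ S.U, S.CoeffEquations E₀ K (ψ t q) (X t q) t q := by
  constructor
  · rintro ⟨h1, h2, h3, h4, ψ, X, h⟩
    have hK : S.IsRegular K := ⟨h1, h2, h3, h4⟩
    exact ⟨hK, ψ, X, fun t q hq => (coeffEquations_iff hK hq).2 (h t q hq)⟩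
  · rintro ⟨hK, ψ, X, h⟩
    exact ⟨hK.quad, hK.lin, hK.scal, hK.symm, ψ, X,
      fun t q hq => (coeffEquations_iff hK hq).1 (h t q hq)⟩

/-! ### Conservation along the motions -/

lemma IsExactQFI.isConserved {E₀ : ℝ} {K : QuadraticFunction n} (h : S.IsExactQFI E₀ K) :
    S.IsConserved E₀ K.eval := by
  obtain ⟨h1, h2, h3, h4, ψ, X, hd⟩ := h
  have hK : S.IsRegular K := ⟨h1, h2, h3, h4⟩
  intro J q q' hJ hJc hm s hs t ht
  have hderiv : ∀ x ∈ J, HasDerivAt (fun r => K.eval r (q r) (q' r)) 0 x := by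
    intro x hx
    obtain ⟨hU, hq, hq', hE⟩ := hm x hx
    have hc := HasFDerivAt.comp_hasDerivAt x
      (l := fun p : ℝ × Coord n × Coord n => K.eval p.1 p.2.1 p.2.2)
      (hK.differentiableAt_eval x hU (q' x)).hasFDerivAt
      ((hasDerivAt_id x).prodMk (hq.prodMk hq'))
    have hshell : S.shell E₀ (q x) (q' x) = 0 := by
      rw [← hE]; simp only [shell, energy]; ring
    have hz := hd x (q x) hU (q' x)
    rw [hshell, mul_zero] at hz
    rw [← hz]
    exact hc
  have hconv : Convex ℝ J := hJc.convex
  exact hJ.is_const_of_deriv_eq_zero hconv.isPreconnected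
    (fun x hx => (hderiv x hx).differentiableAt.differentiableWithinAt)
    (fun x hx => (hderiv x hx).deriv) hs ht

end ConservativeSystem


namespace ConservativeSystem

variable {n : ℕ} {S : ConservativeSystem n} {q : Coord n}

/-! ### Removing a multiple of the energy constraint -/

lemma SmoothTimeScalar.add {f g : ℝ → Coord n → ℝ} (hf : S.SmoothTimeScalar f)
    (hg : S.SmoothTimeScalar g) : S.SmoothTimeScalar fun t q => f t q + g t q :=
  ContDiffOn.add hf hg

lemma SmoothTimeScalar.sub {f g : ℝ → Coord n → ℝ} (hf : S.SmoothTimeScalar f)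
    (hg : S.SmoothTimeScalar g) : S.SmoothTimeScalar fun t q => f t q - g t q :=
  ContDiffOn.sub hf hg

lemma SmoothTimeScalar.mul {f g : ℝ → Coord n → ℝ} (hf : S.SmoothTimeScalar f)
    (hg : S.SmoothTimeScalar g) : S.SmoothTimeScalar fun t q => f t q * g t q :=
  ContDiffOn.mul hf hg

lemma SmoothTimeScalar.sum {ι : Type*} {s : Finset ι} {f : ι → ℝ → Coord n → ℝ}
    (hf : ∀ i ∈ s, S.SmoothTimeScalar (f i)) : S.SmoothTimeScalar fun t q => ∑ i ∈ s, f i t q :=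
  ContDiffOn.sum hf

lemma SmoothScalar.smoothTimeScalar {f : Coord n → ℝ} (hf : S.SmoothScalar f) :
    S.SmoothTimeScalar fun _ q => f q :=
  ContDiffOn.comp (t := S.U) hf contDiffOn_snd fun _ hx => hx.2

variable (S) in
lemma smoothTimeScalar_of_time {g : ℝ → ℝ} (hg : ContDiff ℝ ∞ g) :
    S.SmoothTimeScalar fun t _ => g t :=
  (hg.comp contDiff_fst).contDiffOn

/-- Since the energy is conserved, subtracting `φ (γ_{ab} v^a v^b + 2 (V - E₀))` from a first
integral changes the multipliers `ψ` and `X_a` by `-∂φ/∂t` and `-φ_{,a}`. -/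
lemma CoeffEquations.sub_shell {E₀ : ℝ} {K K' : QuadraticFunction n} (hK' : S.IsRegular K')
    {φ : ℝ → Coord n → ℝ} (hφ : S.SmoothTimeScalar φ)
    (hquad : ∀ t, ∀ q ∈ S.U, ∀ a b, K.quad t q a b = K'.quad t q a b + φ t q * S.γ q a b)
    (hlin : ∀ t, ∀ q ∈ S.U, ∀ a, K.lin t q a = K'.lin t q a)
    (hscal : ∀ t, ∀ q ∈ S.U, K.scal t q = K'.scal t q + 2 * (S.V q - E₀) * φ t q)
    {ψ : ℝ} {X : Fin n → ℝ} {t : ℝ} (hq : q ∈ S.U) (h : S.CoeffEquations E₀ K ψ X t q) :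
    S.CoeffEquations E₀ K' (ψ - deriv (fun s => φ s q) t) (fun a => X a - pd a (φ t) q) t q := by
  have dφ := hφ.hasDerivAt_time t hq
  have pφ := (hφ.at_time t).differentiableAt_coord hq
  obtain ⟨h3, h2, h1, h0⟩ := h
  have hcov : ∀ a b c, S.covDeriv2 (K.quad t) q a b c =
      S.covDeriv2 (K'.quad t) q a b c + pd c (φ t) q * S.γ q a b := by
    intro a b c
    have hK'_quad : S.SmoothSymTensor (K'.quad t) :=
      ⟨fun a b => (hK'.quad a b).at_time t, hK'.symm t⟩
    have hγ : S.SmoothSymTensor (fun x d e => φ t x * S.γ x d e) :=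
      ⟨fun a b => (hφ.at_time t).mul (S.γ_smooth a b), fun x hx a b => by
        simp only [γ_comm hx a b]⟩
    have hdiff := covDeriv2_sub (K := K.quad t)
      (K' := fun x d e => φ t x * S.γ x d e) ?_ hγ hq a b c
    · rw [covDeriv2_mul_γ (hφ.at_time t) hq] at hdiff
      rw [covDeriv2_congr (K := K'.quad t)
        (K' := fun x d e => K.quad t x d e - φ t x * S.γ x d e)
        (fun x hx a b => by rw [hquad t x hx]; ring) hq, hdiff]
      ring
    · refine ⟨fun a b => (((hK'_quad.1 a b).add (hγ.1 a b))).congr fun x hx => hquad t x hx a b, ?_⟩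
      intro x hx a b
      rw [hquad t x hx, hquad t x hx, hK'.symm t x hx a b, γ_comm hx a b]
  refine ⟨fun a b c => ?_, fun a b => ?_, fun a => ?_, ?_⟩
  · have := h3 a b c
    simp only [cycCov, cycMetric, hcov] at this ⊢
    linarith
  · have := h2 a b
    rw [symCov_congr (L' := K'.lin t) (hlin t) hq,
      (funext fun s => hquad s q hq a b :
        (fun s => K.quad s q a b) = fun s => K'.quad s q a b + φ s q * S.γ q a b),
      (((hK'.quad a b).hasDerivAt_time t hq).fun_add (dφ.mul_const (S.γ q a b))).deriv] at this
    linarith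
  · have := h1 a
    have hV := (S.V_smooth.differentiableAt_coord hq).sub_const E₀
    have hpd : pd a (K.scal t) q = pd a (K'.scal t) q + (2 * pd a S.V q * φ t q +
        2 * (S.V q - E₀) * pd a (φ t) q) := by
      rw [pd_congr S.isOpen_U hq (hscal t) a,
        pd_add (g := fun x => 2 * (S.V x - E₀) * φ t x)
          ((hK'.scal.at_time t).differentiableAt_coord hq) ((hV.const_mul 2).fun_mul pφ),
        pd_mul (hV.const_mul 2) pφ, pd_const_mul hV,
        pd_sub (S.V_smooth.differentiableAt_coord hq) (differentiableAt_const E₀)]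
      simp [pd]
    rw [(funext fun s => hlin s q hq a : (fun s => K.lin s q a) = fun s => K'.lin s q a),
      hpd] at this
    have hforce : ∑ b, K.quad t q a b * S.gradV q b =
        (∑ b, K'.quad t q a b * S.gradV q b) + φ t q * pd a S.V q := by
      rw [← γ_contr_gradV hq, Finset.mul_sum, ← Finset.sum_add_distrib]
      exact Finset.sum_congr rfl fun b _ => by rw [hquad t q hq]; ring
    rw [hforce] at this
    linarith
  · rw [contrV_congr (L' := K'.lin t) (hlin t q hq),
      (funext fun s => hscal s q hq :
        (fun s => K.scal s q) = fun s => K'.scal s q + 2 * (S.V q - E₀) * φ s q),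
      ((hK'.scal.hasDerivAt_time t hq).fun_add (dφ.const_mul (2 * (S.V q - E₀)))).deriv] at h0
    linarith

/-! ### Families of integrals generated by covector fields -/

variable {ι : Type*}

variable (S) in
/-- The quadratic function
`(C_{ab} - ∑ g_i(t) L_{i(a;b)}) v^a v^b + ∑ g_i'(t) L_{ia} v^a + G + ∑ g_i(t) L_{ia} V^{,a}`,
of which the three types are special cases. The derivatives `g_i'` are separate data. -/
def familyQFI (s : Finset ι) (g g' : ι → ℝ → ℝ) (C : TensorField2 n) (L : ι → CovectorField n)
    (G : Coord n → ℝ) : QuadraticFunction n where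
  quad t q a b := C q a b - ∑ i ∈ s, g i t * S.symCov (L i) q a b
  lin t q a := ∑ i ∈ s, g' i t * L i q a
  scal t q := G q + ∑ i ∈ s, g i t * S.contrV (L i) q

section Family

variable {s : Finset ι} {g g' : ι → ℝ → ℝ} {C : TensorField2 n} {L : ι → CovectorField n}
  {G : Coord n → ℝ} {E₀ : ℝ}

lemma contDiff_of_hasDerivAt {g g' : ℝ → ℝ} (hg : ContDiff ℝ ∞ g)
    (hg' : ∀ t, HasDerivAt g (g' t) t) : ContDiff ℝ ∞ g' := by
  rw [show g' = deriv g from funext fun t => (hg' t).deriv.symm]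
  exact (contDiff_infty_iff_deriv.1 hg).2

lemma familyQFI_isRegular (hg : ∀ i, ContDiff ℝ ∞ (g i))
    (hg' : ∀ i t, HasDerivAt (g i) (g' i t) t) (hC : S.SmoothSymTensor C)
    (hL : ∀ i ∈ s, S.SmoothCovector (L i)) (hG : S.SmoothScalar G) :
    S.IsRegular (S.familyQFI s g g' C L G) where
  quad a b := (SmoothScalar.smoothTimeScalar (hC.1 a b)).sub <| SmoothTimeScalar.sum fun i hi =>
    (S.smoothTimeScalar_of_time (hg i)).mul
      (SmoothScalar.smoothTimeScalar ((hL i hi).symCov.1 a b))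
  lin a := SmoothTimeScalar.sum fun i hi =>
    (S.smoothTimeScalar_of_time (contDiff_of_hasDerivAt (hg i) (hg' i))).mul
      (SmoothScalar.smoothTimeScalar (hL i hi a))
  scal := hG.smoothTimeScalar.add <| SmoothTimeScalar.sum fun i hi =>
    (S.smoothTimeScalar_of_time (hg i)).mul (hL i hi).contrV.smoothTimeScalar
  symm t q hq a b := by
    simp only [familyQFI, hC.2 q hq a b]
    congr 1
    exact Finset.sum_congr rfl fun i _ => by rw [symCov_comm]

lemma hasDerivAt_sum_mul (hg' : ∀ i t, HasDerivAt (g i) (g' i t) t) (c : ι → ℝ) (t : ℝ) :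
    HasDerivAt (fun r => ∑ i ∈ s, g i r * c i) (∑ i ∈ s, g' i t * c i) t :=
  HasDerivAt.fun_sum fun i _ => (hg' i t).mul_const (c i)

lemma cycCov_familyQFI (hC : S.SmoothSymTensor C) (hL : ∀ i ∈ s, S.SmoothCovector (L i)) (t : ℝ)
    (hq : q ∈ S.U) (a b c : Fin n) : S.cycCov ((S.familyQFI s g g' C L G).quad t) q a b c =
      S.cycCov C q a b c - ∑ i ∈ s, g i t * S.cycCov (S.symCov (L i)) q a b c :=
  cycCov_sub_sum (fun i => g i t) hC (fun i hi => (hL i hi).symCov) hq a b c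

/-- The part of degree one of `dI/dt` for a member of the family. -/
lemma linear_familyQFI (hg : ∀ i, ContDiff ℝ ∞ (g i)) (hg' : ∀ i t, HasDerivAt (g i) (g' i t) t)
    (hL : ∀ i ∈ s, S.SmoothCovector (L i)) (hG : S.SmoothScalar G) (t : ℝ) (hq : q ∈ S.U)
    (a : Fin n) :
    deriv (fun r => (S.familyQFI s g g' C L G).lin r q a) t +
        pd a ((S.familyQFI s g g' C L G).scal t) q -
        2 * ∑ b, (S.familyQFI s g g' C L G).quad t q a b * S.gradV q b =
      pd a G q - 2 * (∑ b, C q a b * S.gradV q b) +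
        ∑ i ∈ s, (deriv (g' i) t * L i q a + g i t *
          (pd a (S.contrV (L i)) q + 2 * ∑ b, S.symCov (L i) q a b * S.gradV q b)) := by
  have h1 : deriv (fun r => ∑ i ∈ s, g' i r * L i q a) t = ∑ i ∈ s, deriv (g' i) t * L i q a :=
    (hasDerivAt_sum_mul (fun i t => (((contDiff_of_hasDerivAt (hg i) (hg' i)).differentiable
      (by simp)) t).hasDerivAt) (fun i => L i q a) t).deriv
  have hd : ∀ i ∈ s, DifferentiableAt ℝ (S.contrV (L i)) q :=
    fun i hi => (hL i hi).contrV.differentiableAt_coord hq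
  have h2 : pd a (fun x => G x + ∑ i ∈ s, g i t * S.contrV (L i) x) q =
      pd a G q + ∑ i ∈ s, g i t * pd a (S.contrV (L i)) q := by
    rw [pd_add (hG.differentiableAt_coord hq)
      (DifferentiableAt.fun_sum fun i hi => (hd i hi).const_mul _),
      pd_sum fun i hi => (hd i hi).const_mul _,
      Finset.sum_congr rfl fun i hi => pd_const_mul (hd i hi) (g i t) a]
  have h3 : ∑ b, (C q a b - ∑ i ∈ s, g i t * S.symCov (L i) q a b) * S.gradV q b =
      (∑ b, C q a b * S.gradV q b) -
        ∑ i ∈ s, g i t * ∑ b, S.symCov (L i) q a b * S.gradV q b := by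
    simp only [sub_mul, Finset.sum_sub_distrib, Finset.sum_mul, Finset.mul_sum, mul_assoc]
    rw [Finset.sum_comm]
  simp only [familyQFI]
  rw [h1, h2, h3]
  simp only [mul_add, Finset.sum_add_distrib, mul_left_comm _ (2 : ℝ), ← Finset.mul_sum]
  ring

/-- A sufficient criterion for a member of the family to be a first integral: the tensors are
conformal Killing, and the part of degree one balances. -/
lemma isExactQFI_familyQFI (hg : ∀ i, ContDiff ℝ ∞ (g i))
    (hg' : ∀ i t, HasDerivAt (g i) (g' i t) t) (hL : ∀ i ∈ s, S.SmoothCovector (L i))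
    (hG : S.SmoothScalar G) {X : CovectorField n} {Y : ι → CovectorField n} (hCX : S.IsCKT C X)
    (hLY : ∀ i ∈ s, S.IsCKT (S.symCov (L i)) (Y i))
    (hrel : ∀ t, ∀ q ∈ S.U, ∀ a,
      pd a G q + ∑ i ∈ s, (deriv (g' i) t * L i q a + g i t *
        (pd a (S.contrV (L i)) q + 2 * (∑ b, S.symCov (L i) q a b * S.gradV q b) +
          2 * (S.V q - E₀) * Y i q a)) =
      2 * (∑ b, C q a b * S.gradV q b) + 2 * (S.V q - E₀) * X q a) :
    S.IsExactQFI E₀ (S.familyQFI s g g' C L G) := by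
  rw [isExactQFI_iff]
  refine ⟨familyQFI_isRegular hg hg' hCX.1 hL hG, fun _ _ => 0,
    fun t q a => X q a - ∑ i ∈ s, g i t * Y i q a, fun t q hq => ⟨?_, ?_, ?_, ?_⟩⟩
  · intro a b c
    rw [cycCov_familyQFI hCX.1 hL t hq, cycMetric_sub_sum]
    congr 1
    · exact hCX.2 q hq a b c
    · exact Finset.sum_congr rfl fun i hi => congrArg _ ((hLY i hi).2 q hq a b c)
  · intro a b
    have h1 : deriv (fun r => (S.familyQFI s g g' C L G).quad r q a b) t =
        -∑ i ∈ s, g' i t * S.symCov (L i) q a b :=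
      ((hasDerivAt_sum_mul hg' (fun i => S.symCov (L i) q a b) t).const_sub (C q a b)).deriv
    have h2 : S.symCov ((S.familyQFI s g g' C L G).lin t) q a b =
        ∑ i ∈ s, g' i t * S.symCov (L i) q a b := symCov_sum (fun i => g' i t) hL hq a b
    rw [h1, h2]; ring
  · intro a
    rw [linear_familyQFI hg hg' hL hG t hq a]
    have := hrel t q hq a
    have e : ∑ i ∈ s, (deriv (g' i) t * L i q a + g i t *
        (pd a (S.contrV (L i)) q + 2 * (∑ b, S.symCov (L i) q a b * S.gradV q b) +
          2 * (S.V q - E₀) * Y i q a)) =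
        ∑ i ∈ s, (deriv (g' i) t * L i q a + g i t *
          (pd a (S.contrV (L i)) q + 2 * ∑ b, S.symCov (L i) q a b * S.gradV q b)) +
        2 * (S.V q - E₀) * ∑ i ∈ s, g i t * Y i q a := by
      rw [Finset.mul_sum, ← Finset.sum_add_distrib]
      exact Finset.sum_congr rfl fun i _ => by ring
    rw [e] at this
    linarith
  · have h1 : deriv (fun r => (S.familyQFI s g g' C L G).scal r q) t =
        ∑ i ∈ s, g' i t * S.contrV (L i) q :=
      ((hasDerivAt_sum_mul hg' (fun i => S.contrV (L i) q) t).const_add (G q)).deriv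
    have h2 : S.contrV ((S.familyQFI s g g' C L G).lin t) q =
        ∑ i ∈ s, g' i t * S.contrV (L i) q := contrV_sum L (fun i => g' i t) q
    rw [h1, h2]; ring

/-- Linear independence of the functions `1` and `g_i`, `i ∈ s`. -/
def TimeIndependent (s : Finset ι) (g : ι → ℝ → ℝ) : Prop :=
  ∀ (c₀ : ℝ) (c : ι → ℝ), (∀ t, c₀ + ∑ i ∈ s, g i t * c i = 0) → c₀ = 0 ∧ ∀ i ∈ s, c i = 0

/-- If the functions `1` and `g_i` are linearly independent, then for a member of the family the
equation of degree three holds for each of `C` and `L_{i(a;b)}` separately. The associated vectors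
are linear in these tensors, being traces. -/
lemma IsExactQFI.familyQFI_conditions (hg : ∀ i, ContDiff ℝ ∞ (g i))
    (hg' : ∀ i t, HasDerivAt (g i) (g' i t) t) (hC : S.SmoothSymTensor C)
    (hL : ∀ i ∈ s, S.SmoothCovector (L i)) (hG : S.SmoothScalar G) (hind : TimeIndependent s g)
    (h : S.IsExactQFI E₀ (S.familyQFI s g g' C L G)) :
    ∃ (X : CovectorField n) (Y : ι → CovectorField n), S.IsCKT C X ∧
      (∀ i ∈ s, S.IsCKT (S.symCov (L i)) (Y i)) ∧
      ∀ t, ∀ q ∈ S.U, ∀ a,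
        pd a G q + ∑ i ∈ s, (deriv (g' i) t * L i q a + g i t *
          (pd a (S.contrV (L i)) q + 2 * (∑ b, S.symCov (L i) q a b * S.gradV q b) +
            2 * (S.V q - E₀) * Y i q a)) =
        2 * (∑ b, C q a b * S.gradV q b) + 2 * (S.V q - E₀) * X q a := by
  rw [isExactQFI_iff] at h
  obtain ⟨-, ψ, Z, h⟩ := h
  set X : CovectorField n := fun q => S.assocVector q (S.cycCov C q)
  set Y : ι → CovectorField n := fun i q => S.assocVector q (S.cycCov (S.symCov (L i)) q)
  have hZ : ∀ t, ∀ q ∈ S.U, Z t q = fun a => X q a - ∑ i ∈ s, g i t * Y i q a := by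
    intro t q hq
    have e : S.cycMetric q (Z t q) = fun a b c => S.cycCov C q a b c -
        ∑ i ∈ s, g i t * S.cycCov (S.symCov (L i)) q a b c := by
      funext a b c
      rw [← (h t q hq).cubic a b c, cycCov_familyQFI hC hL t hq]
    rw [← assocVector_cycMetric hq (Z t q), e]
    funext a
    rw [assocVector_sub, assocVector_sum]
  have hcub : ∀ q ∈ S.U, ∀ a b c,
      S.cycCov C q a b c - S.cycMetric q (X q) a b c = 0 ∧ ∀ i ∈ s,
        S.cycMetric q (Y i q) a b c - S.cycCov (S.symCov (L i)) q a b c = 0 := by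
    intro q hq a b c
    refine hind _ (fun i => S.cycMetric q (Y i q) a b c - S.cycCov (S.symCov (L i)) q a b c) ?_
    intro t
    have := (h t q hq).cubic a b c
    rw [cycCov_familyQFI hC hL t hq, hZ t q hq, cycMetric_sub_sum] at this
    simp only [mul_sub, Finset.sum_sub_distrib]
    linarith
  refine ⟨X, Y, ⟨hC, fun q hq a b c => sub_eq_zero.1 (hcub q hq a b c).1⟩,
    fun i hi => ⟨(hL i hi).symCov, fun q hq a b c =>
      (sub_eq_zero.1 ((hcub q hq a b c).2 i hi)).symm⟩, fun t q hq a => ?_⟩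
  have := (h t q hq).linear a
  rw [linear_familyQFI hg hg' hL hG t hq a, hZ t q hq] at this
  have e : ∑ i ∈ s, (deriv (g' i) t * L i q a + g i t *
      (pd a (S.contrV (L i)) q + 2 * (∑ b, S.symCov (L i) q a b * S.gradV q b) +
        2 * (S.V q - E₀) * Y i q a)) =
      ∑ i ∈ s, (deriv (g' i) t * L i q a + g i t *
        (pd a (S.contrV (L i)) q + 2 * ∑ b, S.symCov (L i) q a b * S.gradV q b)) +
      2 * (S.V q - E₀) * ∑ i ∈ s, g i t * Y i q a := by
    rw [Finset.mul_sum, ← Finset.sum_add_distrib]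
    exact Finset.sum_congr rfl fun i _ => by ring
  rw [e]
  linarith

/-- A first integral whose linear part is `∑ g_i'(t) L_{ia} v^a` is, modulo the energy constraint,
a member of the family. The multiple of the constraint to be removed is `1/n` times the
trace of `K_{ab} + ∑ g_i L_{i(a;b)}`: the time derivative of this tensor is `ψ γ_{ab}`, so its
trace-free part does not depend on time. -/
lemma IsExactQFI.exists_familyQFI (hn : 1 ≤ n) {K : QuadraticFunction n}
    (hg : ∀ i, ContDiff ℝ ∞ (g i))
    (hg' : ∀ i t, HasDerivAt (g i) (g' i t) t) (hL : ∀ i ∈ s, S.SmoothCovector (L i))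
    (h : S.IsExactQFI E₀ K)
    (hlin : ∀ t, ∀ q ∈ S.U, ∀ a, K.lin t q a = ∑ i ∈ s, g' i t * L i q a) :
    ∃ (C : TensorField2 n) (G : Coord n → ℝ) (φ : ℝ → Coord n → ℝ),
      S.SmoothSymTensor C ∧ S.SmoothScalar G ∧ (∀ q ∈ S.U, S.trace2 q (C q) = 0) ∧
      S.IsExactQFI E₀ (S.familyQFI s g g' C L G) ∧
      (∀ t, ∀ q ∈ S.U, ∀ a b, K.quad t q a b =
        (S.familyQFI s g g' C L G).quad t q a b + φ t q * S.γ q a b) ∧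
      S.CongrShell E₀ K.eval (S.familyQFI s g g' C L G).eval := by
  have hn0 : (n : ℝ) ≠ 0 := by positivity
  rw [isExactQFI_iff] at h
  obtain ⟨hK, ψ, Z, h⟩ := h
  -- the tensor with time derivative `ψ γ_{ab}`, and the antiderivative `φ` of `ψ`
  set R : ℝ → TensorField2 n := fun t q a b =>
    K.quad t q a b + ∑ i ∈ s, g i t * S.symCov (L i) q a b
  set φ : ℝ → Coord n → ℝ := fun t q => (1 / n : ℝ) * S.trace2 q (R t q)
  have hRsmooth : ∀ a b, S.SmoothTimeScalar fun t q => R t q a b := fun a b =>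
    (hK.quad a b).add <| SmoothTimeScalar.sum fun i hi =>
      (S.smoothTimeScalar_of_time (hg i)).mul
        (SmoothScalar.smoothTimeScalar ((hL i hi).symCov.1 a b))
  have hφ : S.SmoothTimeScalar φ := by
    refine SmoothTimeScalar.mul (f := fun _ _ => (1 / n : ℝ)) contDiffOn_const ?_
    exact SmoothTimeScalar.sum fun a _ => SmoothTimeScalar.sum fun b _ =>
      (SmoothScalar.smoothTimeScalar (S.inv_smooth a b)).mul (hRsmooth a b)
  have hRsymm : ∀ t, ∀ q ∈ S.U, ∀ a b, R t q a b = R t q b a := fun t q hq a b => by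
    simp only [R, hK.symm t q hq a b]
    congr 1
    exact Finset.sum_congr rfl fun i _ => by rw [symCov_comm]
  have hRderiv : ∀ t, ∀ q ∈ S.U, ∀ a b,
      HasDerivAt (fun r => R r q a b) (ψ t q * S.γ q a b) t := by
    intro t q hq a b
    rw [← (h t q hq).quadratic a b, symCov_congr (hlin t) hq, symCov_sum (fun i => g' i t) hL hq]
    exact ((hK.quad a b).hasDerivAt_time t hq).fun_add
      (hasDerivAt_sum_mul hg' (fun i => S.symCov (L i) q a b) t)
  have hφderiv : ∀ t, ∀ q ∈ S.U, HasDerivAt (fun r => φ r q) (ψ t q) t := by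
    intro t q hq
    have h1 : HasDerivAt (fun r => φ r q)
        ((1 / n : ℝ) * S.trace2 q (fun a b => ψ t q * S.γ q a b)) t :=
      (HasDerivAt.fun_sum fun a _ => HasDerivAt.fun_sum fun b _ =>
        (hRderiv t q hq a b).const_mul _).const_mul _
    rw [trace2_mul_γ hq] at h1
    rwa [one_div, inv_mul_cancel_left₀ hn0] at h1
  set C : TensorField2 n := fun q a b => R 0 q a b - φ 0 q * S.γ q a b
  set G : Coord n → ℝ := fun q =>
    K.scal 0 q - 2 * (S.V q - E₀) * φ 0 q - ∑ i ∈ s, g i 0 * S.contrV (L i) q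
  have hC : S.SmoothSymTensor C :=
    ⟨fun a b => ((hRsmooth a b).at_time 0).sub ((hφ.at_time 0).mul (S.γ_smooth a b)),
      fun q hq a b => by simp only [C, hRsymm 0 q hq a b, γ_comm hq a b]⟩
  have hG : S.SmoothScalar G :=
    ((hK.scal.at_time 0).sub ((contDiffOn_const.mul (S.V_smooth.sub contDiffOn_const)).mul
      (hφ.at_time 0))).sub
      (ContDiffOn.sum fun i hi => contDiffOn_const.mul (hL i hi).contrV)
  have hquad : ∀ t, ∀ q ∈ S.U, ∀ a b, K.quad t q a b =
      (S.familyQFI s g g' C L G).quad t q a b + φ t q * S.γ q a b := by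
    intro t q hq a b
    have hd : ∀ r, HasDerivAt (fun r => R r q a b - φ r q * S.γ q a b) 0 r := fun r => by
      simpa using (hRderiv r q hq a b).fun_sub ((hφderiv r q hq).mul_const (S.γ q a b))
    have hconst := is_const_of_deriv_eq_zero (fun r => (hd r).differentiableAt)
      (fun r => (hd r).deriv) t 0
    simp only [familyQFI, C]
    rw [← hconst]
    simp only [R]
    ring
  have hscal : ∀ t, ∀ q ∈ S.U, K.scal t q =
      (S.familyQFI s g g' C L G).scal t q + 2 * (S.V q - E₀) * φ t q := by
    intro t q hq
    have hd : ∀ r, HasDerivAt (fun r => K.scal r q - 2 * (S.V q - E₀) * φ r q -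
        ∑ i ∈ s, g i r * S.contrV (L i) q) 0 r := fun r => by
      have h1 := ((hK.scal.hasDerivAt_time r hq).fun_sub
        ((hφderiv r q hq).const_mul (2 * (S.V q - E₀)))).fun_sub
        (hasDerivAt_sum_mul (s := s) hg' (fun i => S.contrV (L i) q) r)
      have h2 := (h r q hq).constant
      rw [contrV_congr (L' := fun x a => ∑ i ∈ s, g' i r * L i x a) (hlin r q hq),
        contrV_sum] at h2
      exact h1.congr_deriv (by linarith)
    have hconst := is_const_of_deriv_eq_zero (fun r => (hd r).differentiableAt)
      (fun r => (hd r).deriv) t 0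
    simp only [familyQFI, G]
    rw [← hconst]
    ring
  have hreg : S.IsRegular (S.familyQFI s g g' C L G) := familyQFI_isRegular hg hg' hC hL hG
  refine ⟨C, G, φ, hC, hG, fun q hq => ?_, ?_, hquad, φ, fun t q hq v => ?_⟩
  · simp only [C]
    rw [trace2_sub, trace2_mul_γ hq]
    simp only [φ]
    field_simp
    simp
  · rw [isExactQFI_iff]
    exact ⟨hreg, _, _, fun t q hq => (h t q hq).sub_shell hreg hφ hquad hlin hscal hq⟩
  · have e : ∑ a, ∑ b, K.quad t q a b * v a * v b =
        ∑ a, ∑ b, (S.familyQFI s g g' C L G).quad t q a b * v a * v b +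
          φ t q * ∑ a, ∑ b, S.γ q a b * v a * v b := by
      simp only [hquad t q hq, Finset.mul_sum, ← Finset.sum_add_distrib]
      exact Finset.sum_congr rfl fun a _ => Finset.sum_congr rfl fun b _ => by ring
    have e' : ∑ a, K.lin t q a * v a = ∑ a, (S.familyQFI s g g' C L G).lin t q a * v a :=
      Finset.sum_congr rfl fun a _ => by rw [hlin t q hq]; rfl
    simp only [QuadraticFunction.eval, shell]
    rw [e, e', hscal t q hq]
    ring

end Family

end ConservativeSystem


/-! ### Powers and exponentials of the time -/

/-- The primitive `t^{p+1} / (p + 1)` of `t^p`. -/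
def powPrimitive (p : ℕ) (t : ℝ) : ℝ := t ^ (p + 1) / (p + 1 : ℝ)

lemma powPrimitive_contDiff (p : ℕ) : ContDiff ℝ ∞ (powPrimitive p) := by
  unfold powPrimitive; fun_prop

lemma hasDerivAt_powPrimitive (p : ℕ) (t : ℝ) : HasDerivAt (powPrimitive p) (t ^ p) t := by
  have h := (hasDerivAt_pow (p + 1) t).div_const (p + 1 : ℝ)
  have hp : (p + 1 : ℝ) ≠ 0 := by positivity
  refine h.congr_deriv ?_
  rw [Nat.add_sub_cancel]
  push_cast
  field_simp

lemma powPrimitive_two_mul_sub_one {k : ℕ} (hk : 1 ≤ k) (t : ℝ) :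
    powPrimitive (2 * k - 1) t = t ^ (2 * k) / (2 * k : ℝ) := by
  obtain ⟨j, rfl⟩ : ∃ j, k = j + 1 := ⟨k - 1, by omega⟩
  rw [show 2 * (j + 1) - 1 = 2 * j + 1 by omega, powPrimitive]
  push_cast
  ring_nf

lemma powPrimitive_two_mul (k : ℕ) (t : ℝ) :
    powPrimitive (2 * k) t = t ^ (2 * k + 1) / (2 * k + 1 : ℝ) := by
  rw [powPrimitive]; push_cast; rfl

lemma hasDerivAt_exp_mul (lam t : ℝ) :
    HasDerivAt (fun r => Real.exp (lam * r)) (lam * Real.exp (lam * t)) t := by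
  simpa [mul_comm] using ((hasDerivAt_id t).const_mul lam).exp

/-- Polynomials and the exponentials `e^{λt}`, `λ ≠ 0`, are linearly independent. Differentiating
and subtracting `λ₀` times the relation removes the exponential with exponent `λ₀`. -/
lemma polynomial_exp_independent (Λ : Finset ℝ) (h0 : (0 : ℝ) ∉ Λ) :
    ∀ (P : Polynomial ℝ) (d : ℝ → ℝ),
      (∀ t, P.eval t + ∑ lam ∈ Λ, Real.exp (lam * t) * d lam = 0) →
      P = 0 ∧ ∀ lam ∈ Λ, d lam = 0 := by
  classical
  induction Λ using Finset.induction_on with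
  | empty =>
    intro P d h
    exact ⟨Polynomial.funext fun t => by simpa using h t, by simp⟩
  | insert μ Λ hμ ih =>
    intro P d h
    have hμ0 : μ ≠ 0 := fun h => h0 (by simp [h])
    have hΛ : (0 : ℝ) ∉ Λ := fun h => h0 (by simp [h])
    have hstep : ∀ t, (P.derivative - Polynomial.C μ * P).eval t +
        ∑ lam ∈ Λ, Real.exp (lam * t) * ((lam - μ) * d lam) = 0 := by
      intro t
      have hd : HasDerivAt (fun r => P.eval r + ∑ lam ∈ insert μ Λ, Real.exp (lam * r) * d lam)
          (P.derivative.eval t + ∑ lam ∈ insert μ Λ, lam * Real.exp (lam * t) * d lam) t :=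
        (P.hasDerivAt t).fun_add
          (HasDerivAt.fun_sum fun lam _ => (hasDerivAt_exp_mul lam t).mul_const (d lam))
      rw [funext h] at hd
      have h1 := hd.unique (hasDerivAt_const t (0 : ℝ))
      have h2 := h t
      rw [Finset.sum_insert hμ] at h1 h2
      have e : ∑ lam ∈ Λ, Real.exp (lam * t) * ((lam - μ) * d lam) =
          ∑ lam ∈ Λ, lam * Real.exp (lam * t) * d lam -
            μ * ∑ lam ∈ Λ, Real.exp (lam * t) * d lam := by
        rw [Finset.mul_sum, ← Finset.sum_sub_distrib]
        exact Finset.sum_congr rfl fun lam _ => by ring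
      rw [e]
      simp only [Polynomial.eval_sub, Polynomial.eval_mul, Polynomial.eval_C]
      linear_combination h1 - μ * h2
    obtain ⟨hP, hd⟩ := ih hΛ _ _ hstep
    -- `P' = μ P` is impossible for a nonzero polynomial, by degree
    have hP0 : P = 0 := by
      by_contra hne
      have h1 := Polynomial.degree_derivative_lt hne
      rw [sub_eq_zero.1 hP, Polynomial.degree_C_mul hμ0] at h1
      exact lt_irrefl _ h1
    have hd0 : ∀ lam ∈ Λ, d lam = 0 := fun lam hl =>
      (mul_eq_zero.1 (hd lam hl)).resolve_left
        (sub_ne_zero.2 fun e => hμ (e ▸ hl))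
    refine ⟨hP0, fun lam hl => ?_⟩
    rcases Finset.mem_insert.1 hl with rfl | hl
    · have := h 0
      rw [Finset.sum_insert hμ, Finset.sum_eq_zero (s := Λ)
        (fun x hx => by rw [hd0 x hx, mul_zero]),
        hP0] at this
      simpa using this
    · exact hd0 lam hl

lemma sum_Icc_one {M : Type*} [AddCommMonoid M] (f : ℕ → M) (ℓ : ℕ) :
    ∑ k ∈ Finset.Icc 1 ℓ, f k = ∑ k ∈ Finset.range ℓ, f (k + 1) := by
  induction ℓ with
  | zero => simp
  | succ ℓ ih => rw [Finset.sum_Icc_succ_top (by omega), ih, Finset.sum_range_succ]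

/-- Separation of a sum into its terms of odd and of even index. -/
lemma sum_range_odd_add_even {M : Type*} [AddCommMonoid M] (f : ℕ → M) (ℓ : ℕ) :
    ∑ p ∈ Finset.range (2 * ℓ + 1), f p =
      ∑ k ∈ Finset.Icc 1 ℓ, f (2 * k - 1) + ∑ k ∈ Finset.range (ℓ + 1), f (2 * k) := by
  induction ℓ with
  | zero => simp
  | succ ℓ ih =>
    rw [show 2 * (ℓ + 1) + 1 = 2 * ℓ + 1 + 1 + 1 by ring, Finset.sum_range_succ,
      Finset.sum_range_succ, ih, Finset.sum_Icc_succ_top (by omega),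
      Finset.sum_range_succ _ (ℓ + 1)]
    rw [show 2 * (ℓ + 1) - 1 = 2 * ℓ + 1 by omega, show 2 * (ℓ + 1) = 2 * ℓ + 1 + 1 by ring]
    abel

/-- The functions `t^{p+1} / (p + 1)` and `e^{λt}`. -/
def polyExp : ℕ ⊕ ℝ → ℝ → ℝ := Sum.elim powPrimitive fun lam t => Real.exp (lam * t)

/-- The derivatives of the functions `polyExp`. -/
def polyExpDeriv : ℕ ⊕ ℝ → ℝ → ℝ :=
  Sum.elim (fun p t => t ^ p) fun lam t => lam * Real.exp (lam * t)

lemma polyExp_contDiff (i : ℕ ⊕ ℝ) : ContDiff ℝ ∞ (polyExp i) := by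
  rcases i with p | lam
  · exact powPrimitive_contDiff p
  · simp only [polyExp, Sum.elim_inr]; fun_prop

lemma hasDerivAt_polyExp (i : ℕ ⊕ ℝ) (t : ℝ) : HasDerivAt (polyExp i) (polyExpDeriv i t) t := by
  rcases i with p | lam
  · exact hasDerivAt_powPrimitive p t
  · exact hasDerivAt_exp_mul lam t

lemma deriv_pow_time (p : ℕ) (t : ℝ) : deriv (fun r : ℝ => r ^ p) t = p * t ^ (p - 1) := by simp

lemma deriv_mul_exp (lam t : ℝ) :
    deriv (fun r => lam * Real.exp (lam * r)) t = Real.exp (lam * t) * lam ^ 2 := by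
  rw [((hasDerivAt_exp_mul lam t).const_mul lam).deriv]; ring

lemma timeIndependent_polyExp (N : ℕ) {Λ : Finset ℝ} (h0 : (0 : ℝ) ∉ Λ) :
    ConservativeSystem.TimeIndependent ((Finset.range N).disjSum Λ) polyExp := by
  intro c₀ c h
  simp only [Finset.sum_disjSum, polyExp, Sum.elim_inl, Sum.elim_inr, powPrimitive] at h
  obtain ⟨hP, hd⟩ := polynomial_exp_independent Λ h0
    (Polynomial.C c₀ + ∑ p ∈ Finset.range N,
      Polynomial.C (c (Sum.inl p) / (p + 1 : ℝ)) * Polynomial.X ^ (p + 1))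
    (fun lam => c (Sum.inr lam))
    (fun t => by
      rw [← h t]
      simp only [Polynomial.eval_add, Polynomial.eval_C, Polynomial.eval_finsetSum,
        Polynomial.eval_mul, Polynomial.eval_pow, Polynomial.eval_X, add_assoc]
      congr 2
      exact Finset.sum_congr rfl fun p _ => by ring)
  refine ⟨?_, ?_⟩
  · have := congrArg (fun P => Polynomial.coeff P 0) hP
    simpa [Polynomial.finsetSum_coeff, Polynomial.coeff_C_mul, Polynomial.coeff_X_pow] using this
  · intro i hi
    rcases i with p | lam
    · have hp : p ∈ Finset.range N := by simpa using hi
      have := congrArg (fun P => Polynomial.coeff P (p + 1)) hP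
      simp only [Polynomial.coeff_add, Polynomial.coeff_C_succ, Polynomial.finsetSum_coeff,
        Polynomial.coeff_C_mul, Polynomial.coeff_X_pow, add_left_inj, mul_ite, mul_one, mul_zero,
        Finset.sum_ite_eq, hp, if_true, zero_add, Polynomial.coeff_zero] at this
      have hp1 : (p + 1 : ℝ) ≠ 0 := by positivity
      exact (div_eq_zero_iff.1 this).resolve_right hp1
    · exact hd lam (by simpa using hi)

lemma timeIndependent_exp {Λ : Finset ℝ} (h0 : (0 : ℝ) ∉ Λ) :
    ConservativeSystem.TimeIndependent Λ fun lam t => Real.exp (lam * t) := by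
  intro c₀ c h
  obtain ⟨hP, hd⟩ := polynomial_exp_independent Λ h0 (Polynomial.C c₀) c
    (fun t => by simpa using h t)
  exact ⟨by simpa using hP, hd⟩

namespace ConservativeSystem

variable {n : ℕ} {S : ConservativeSystem n} {q : Coord n} {E₀ : ℝ}

/-! ### The three types are first integrals -/

lemma isCKT_zero : S.IsCKT (fun _ _ _ => 0) (fun _ _ => 0) :=
  ⟨⟨fun _ _ => contDiffOn_const, fun _ _ _ _ => rfl⟩, fun _ _ _ _ _ => by
    simp [covDeriv2, pd_zero]⟩

lemma integralOne_eq_familyQFI (ℓ : ℕ) (C : TensorField2 n) (L : ℕ → CovectorField n)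
    (G : Coord n → ℝ) :
    S.integralOne ℓ C L G = S.familyQFI (Finset.range ℓ) (fun k => powPrimitive (2 * k + 1))
      (fun k t => t ^ (2 * k + 1)) C (fun k => L (2 * k + 1)) G := by
  have e : ∀ k : ℕ, 2 * (k + 1) - 1 = 2 * k + 1 := fun k => by omega
  have e' : ∀ (k : ℕ) (t : ℝ),
      powPrimitive (2 * k + 1) t = t ^ (2 * (k + 1)) / (2 * ((k + 1 : ℕ) : ℝ)) := fun k t => by
    rw [← powPrimitive_two_mul_sub_one (by omega), e]
  simp only [integralOne, familyQFI, sum_Icc_one, e, e', QuadraticFunction.mk.injEq, neg_add_eq_sub,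
    true_and]
  funext t q
  rw [add_comm]

lemma integralTwo_eq_familyQFI (ℓ : ℕ) (L : ℕ → CovectorField n) :
    S.integralTwo ℓ L = S.familyQFI (Finset.range (ℓ + 1)) (fun k => powPrimitive (2 * k))
      (fun k t => t ^ (2 * k)) (fun _ _ _ => 0) (fun k => L (2 * k)) (fun _ => 0) := by
  simp [integralTwo, familyQFI, powPrimitive]

lemma integralExp_eq_familyQFI (lam : ℝ) (L : CovectorField n) :
    S.integralExp lam L = S.familyQFI {()} (fun _ t => Real.exp (lam * t))
      (fun _ t => lam * Real.exp (lam * t)) (fun _ _ _ => 0) (fun _ => L) (fun _ => 0) := by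
  simp [integralExp, familyQFI]
  funext t q a
  ring

lemma CondOne.isExactQFI {ℓ : ℕ} {C : TensorField2 n} {L : ℕ → CovectorField n} {G : Coord n → ℝ}
    (h : S.CondOne E₀ ℓ C L G) : S.IsExactQFI E₀ (S.integralOne ℓ C L G) := by
  obtain ⟨hG, hL, X, Y, hC, hLY, htop, hrec, hGrel⟩ := h
  have hmem : ∀ k ∈ Finset.range ℓ, k + 1 ∈ Finset.Icc 1 ℓ := fun k hk => by
    simp only [Finset.mem_range] at hk; simp; omega
  have hL' : ∀ k ∈ Finset.range ℓ, S.SmoothCovector (L (2 * k + 1)) :=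
    fun k hk => hL (k + 1) (hmem k hk)
  have hLY' : ∀ k ∈ Finset.range ℓ, S.IsCKT (S.symCov (L (2 * k + 1))) (Y (2 * k + 1)) :=
    fun k hk => hLY (k + 1) (hmem k hk)
  rw [integralOne_eq_familyQFI]
  refine isExactQFI_familyQFI (fun k => powPrimitive_contDiff _)
    (fun k => hasDerivAt_powPrimitive _) hL' hG hC hLY' ?_
  intro t q hq a
  -- the sum telescopes, leaving only the term with `L_{(1)}`
  let u : ℕ → ℝ := fun k => (2 * k + 1) * t ^ (2 * k) * if k < ℓ then L (2 * k + 1) q a else 0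
  have hterm : ∀ k ∈ Finset.range ℓ, (deriv (fun r : ℝ => r ^ (2 * k + 1)) t * L (2 * k + 1) q a +
      powPrimitive (2 * k + 1) t * (pd a (S.contrV (L (2 * k + 1))) q +
        2 * (∑ b, S.symCov (L (2 * k + 1)) q a b * S.gradV q b) +
        2 * (S.V q - E₀) * Y (2 * k + 1) q a)) = u k - u (k + 1) := by
    intro k hk
    have hkℓ : k < ℓ := Finset.mem_range.1 hk
    have hk2 : (2 * k + 2 : ℝ) ≠ 0 := by positivity
    have hbracket : pd a (S.contrV (L (2 * k + 1))) q +
        2 * (∑ b, S.symCov (L (2 * k + 1)) q a b * S.gradV q b) +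
        2 * (S.V q - E₀) * Y (2 * k + 1) q a =
        -((2 * k + 2) * (2 * k + 3)) * if k + 1 < ℓ then L (2 * (k + 1) + 1) q a else 0 := by
      by_cases hlt : k + 1 < ℓ
      · have := hrec (k + 1) (by omega) hlt q hq a
        rw [show 2 * (k + 1) - 1 = 2 * k + 1 by omega] at this
        rw [if_pos hlt, this]
        push_cast
        ring
      · obtain rfl : ℓ = k + 1 := by omega
        have := htop (by omega) q hq a
        rw [show 2 * (k + 1) - 1 = 2 * k + 1 by omega] at this
        rw [if_neg hlt, this]
        ring
    rw [hbracket, deriv_pow_time]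
    simp only [u, hkℓ, if_true, powPrimitive, Nat.add_sub_cancel]
    push_cast
    rw [show (2 * (k : ℝ) + 1 + 1) = 2 * k + 2 by ring]
    field_simp
    ring
  rw [Finset.sum_congr rfl hterm, Finset.sum_range_sub', hGrel q hq a]
  simp [u]

lemma CondTwo.isExactQFI {ℓ : ℕ} {L : ℕ → CovectorField n} (h : S.CondTwo E₀ ℓ L) :
    S.IsExactQFI E₀ (S.integralTwo ℓ L) := by
  obtain ⟨hL, Y, hLY, htop, hrec⟩ := h
  have hmem : ∀ k ∈ Finset.range (ℓ + 1), k ≤ ℓ := fun k hk => by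
    simp only [Finset.mem_range] at hk; omega
  rw [integralTwo_eq_familyQFI]
  refine isExactQFI_familyQFI (Y := fun k => Y (2 * k)) (fun k => powPrimitive_contDiff _)
    (fun k => hasDerivAt_powPrimitive _) (fun k hk => hL k (hmem k hk)) contDiffOn_const isCKT_zero
    (fun k hk => hLY k (hmem k hk)) ?_
  intro t q hq a
  -- the sum telescopes to zero
  let u : ℕ → ℝ := fun k => 2 * k * t ^ (2 * k - 1) * if k ≤ ℓ then L (2 * k) q a else 0
  have hterm : ∀ k ∈ Finset.range (ℓ + 1), (deriv (fun r : ℝ => r ^ (2 * k)) t * L (2 * k) q a +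
      powPrimitive (2 * k) t * (pd a (S.contrV (L (2 * k))) q +
        2 * (∑ b, S.symCov (L (2 * k)) q a b * S.gradV q b) +
        2 * (S.V q - E₀) * Y (2 * k) q a)) = u k - u (k + 1) := by
    intro k hk
    have hkℓ : k ≤ ℓ := hmem k hk
    have hk2 : (2 * k + 1 : ℝ) ≠ 0 := by positivity
    have hbracket : pd a (S.contrV (L (2 * k))) q +
        2 * (∑ b, S.symCov (L (2 * k)) q a b * S.gradV q b) +
        2 * (S.V q - E₀) * Y (2 * k) q a =
        -(2 * (k + 1) * (2 * k + 1)) * if k + 1 ≤ ℓ then L (2 * (k + 1)) q a else 0 := by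
      by_cases hlt : k + 1 ≤ ℓ
      · have := hrec k (by omega) q hq a
        rw [if_pos hlt, this, show 2 * (k + 1) = 2 * k + 2 by ring]
        ring
      · obtain rfl : ℓ = k := by omega
        have := htop q hq a
        rw [if_neg hlt, this]
        ring
    rw [hbracket, deriv_pow_time]
    simp only [u, hkℓ, if_true, powPrimitive, show 2 * (k + 1) - 1 = 2 * k + 1 by omega]
    push_cast
    field_simp
    ring
  rw [Finset.sum_congr rfl hterm, Finset.sum_range_sub']
  simp [u, pd_zero]

lemma CondExp.isExactQFI {lam : ℝ} {L : CovectorField n} (h : S.CondExp E₀ lam L) :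
    S.IsExactQFI E₀ (S.integralExp lam L) := by
  obtain ⟨hL, Y, hLY, hrel⟩ := h
  rw [integralExp_eq_familyQFI]
  refine isExactQFI_familyQFI (Y := fun _ => Y) (fun _ => by fun_prop)
    (fun _ => hasDerivAt_exp_mul lam) (fun _ _ => hL) contDiffOn_const isCKT_zero
    (fun _ _ => hLY) ?_
  intro t q hq a
  rw [Finset.sum_singleton, deriv_mul_exp, hrel q hq a, pd_zero]
  simp
  ring

end ConservativeSystem


namespace ConservativeSystem

variable {n : ℕ} {S : ConservativeSystem n} {q : Coord n} {E₀ : ℝ}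

/-! ### Decomposition into the three types -/

lemma eval_add_add_sum {κ : Type*} {Λ : Finset κ} {K A B : QuadraticFunction n}
    {D : κ → QuadraticFunction n} {t : ℝ}
    (hquad : ∀ a b, K.quad t q a b = A.quad t q a b + B.quad t q a b + ∑ i ∈ Λ, (D i).quad t q a b)
    (hlin : ∀ a, K.lin t q a = A.lin t q a + B.lin t q a + ∑ i ∈ Λ, (D i).lin t q a)
    (hscal : K.scal t q = A.scal t q + B.scal t q + ∑ i ∈ Λ, (D i).scal t q) (v : Coord n) :
    K.eval t q v = A.eval t q v + B.eval t q v + ∑ i ∈ Λ, (D i).eval t q v := by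
  have h2 : ∑ a, ∑ b, (∑ i ∈ Λ, (D i).quad t q a b) * v a * v b =
      ∑ i ∈ Λ, ∑ a, ∑ b, (D i).quad t q a b * v a * v b := by
    simp only [Finset.sum_mul]
    simp only [Finset.sum_comm (t := Λ)]
  have h1 : ∑ a, (∑ i ∈ Λ, (D i).lin t q a) * v a =
      ∑ i ∈ Λ, ∑ a, (D i).lin t q a * v a := by
    simp only [Finset.sum_mul]
    rw [Finset.sum_comm]
  simp only [QuadraticFunction.eval, hquad, hlin, hscal, add_mul, Finset.sum_add_distrib, h1, h2]
  ring

/-- A first integral with polynomial and exponential coefficients is, modulo the energy constraint,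
the sum of integrals of the three types. -/
lemma IsExactQFI.exists_decomposition (hn : 1 ≤ n) {m : ℕ} {Λ : Finset ℝ}
    {K : QuadraticFunction n} (h0 : (0 : ℝ) ∉ Λ) (hK : S.IsExactQFI E₀ K)
    (hpoly : S.HasPolyExpCoeffs m Λ K) :
    ∃ (ℓ₁ : ℕ) (C : TensorField2 n) (L₁ : ℕ → CovectorField n) (G : Coord n → ℝ)
      (ℓ₂ : ℕ) (L₂ : ℕ → CovectorField n) (M : ℝ → CovectorField n),
      S.CondOne E₀ ℓ₁ C L₁ G ∧ S.CondTwo E₀ ℓ₂ L₂ ∧ (∀ lam ∈ Λ, S.CondExp E₀ lam (M lam)) ∧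
      S.CongrShell E₀ K.eval (fun t q v =>
        (S.integralOne ℓ₁ C L₁ G).eval t q v + (S.integralTwo ℓ₂ L₂).eval t q v +
          ∑ lam ∈ Λ, (S.integralExp lam (M lam)).eval t q v) := by
  obtain ⟨_, L', _, M', hCL, hDM, hcoef⟩ := hpoly
  -- `L'` is continued by zero; then powers below `t ^ (2 * m + 1)` may be used throughout
  let L : ℕ → CovectorField n := fun p q a => if p < m then L' p q a else 0
  -- type 3 has linear coefficient `lam * exp (lam * t) * M`
  let M : ℝ → CovectorField n := fun lam q a => lam⁻¹ * M' lam q a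
  let F : ℕ ⊕ ℝ → CovectorField n := Sum.elim L M
  set s : Finset (ℕ ⊕ ℝ) := (Finset.range (2 * m + 1)).disjSum Λ with hs
  have hne : ∀ lam ∈ Λ, lam ≠ 0 := fun lam hl e => h0 (e ▸ hl)
  have hLzero : ∀ p, m ≤ p → ∀ q a, L p q a = 0 := fun p hp q a => if_neg (by omega)
  have hL : ∀ p, S.SmoothCovector (L p) := by
    intro p
    by_cases hp : p < m
    · simpa only [L, hp, if_true] using (hCL p hp).2
    · intro a
      simpa only [L, hp, if_false] using contDiffOn_const
  have hM : ∀ lam ∈ Λ, S.SmoothCovector (M lam) := fun lam hl => (hDM lam hl).2.const_mul _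
  have hF : ∀ i ∈ s, S.SmoothCovector (F i) := by
    rintro (p | lam) hi
    · exact hL p
    · exact hM lam (by simpa [hs] using hi)
  have hlin : ∀ t, ∀ q ∈ S.U, ∀ a, K.lin t q a = ∑ i ∈ s, polyExpDeriv i t * F i q a := by
    intro t q hq a
    rw [(hcoef t q hq).2 a, hs, Finset.sum_disjSum]
    simp only [polyExpDeriv, F, Sum.elim_inl, Sum.elim_inr, L, M, mul_ite, mul_zero]
    congr 1
    · rw [← Finset.sum_filter]
      refine Finset.sum_congr ?_ fun _ _ => rfl
      ext p; simp; omega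
    · refine Finset.sum_congr rfl fun lam hl => ?_
      have := hne lam hl
      field_simp
  obtain ⟨C, G, φ, hC, hG, -, hfam, -, hcongr⟩ :=
    hK.exists_familyQFI hn polyExp_contDiff hasDerivAt_polyExp hF hlin
  obtain ⟨X, Y, hCX, hFY, hrel⟩ := hfam.familyQFI_conditions polyExp_contDiff hasDerivAt_polyExp
    hC hF hG (timeIndependent_polyExp _ h0)
  have hLY : ∀ p < 2 * m + 1, S.IsCKT (S.symCov (L p)) (Y (Sum.inl p)) := fun p hp =>
    hFY (Sum.inl p) (by simpa [hs] using hp)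
  have hMY : ∀ lam ∈ Λ, S.IsCKT (S.symCov (M lam)) (Y (Sum.inr lam)) := fun lam hl =>
    hFY (Sum.inr lam) (by simpa [hs] using hl)
  -- comparison of the coefficients of `1`, `t ^ (p + 1)` and `e ^ (lam * t)` in degree one
  have hcmp : ∀ q ∈ S.U, ∀ a,
      (pd a G q + L 1 q a - 2 * (∑ b, C q a b * S.gradV q b) - 2 * (S.V q - E₀) * X q a = 0) ∧
      ∀ i ∈ s, (Sum.elim (fun p : ℕ => (p + 1 : ℝ) * (p + 2) * L (p + 2) q a)
          (fun lam => lam ^ 2 * M lam q a) i) +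
        (pd a (S.contrV (F i)) q + 2 * (∑ b, S.symCov (F i) q a b * S.gradV q b) +
          2 * (S.V q - E₀) * Y i q a) = 0 := by
    intro q hq a
    refine timeIndependent_polyExp (2 * m + 1) h0 _ (fun i =>
      (Sum.elim (fun p : ℕ => (p + 1 : ℝ) * (p + 2) * L (p + 2) q a)
          (fun lam => lam ^ 2 * M lam q a) i) +
        (pd a (S.contrV (F i)) q + 2 * (∑ b, S.symCov (F i) q a b * S.gradV q b) +
          2 * (S.V q - E₀) * Y i q a)) fun t => ?_
    have h := hrel t q hq a
    have hshift : L 1 q a + ∑ i ∈ s, polyExp i t *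
        (Sum.elim (fun p : ℕ => (p + 1 : ℝ) * (p + 2) * L (p + 2) q a)
          (fun lam => lam ^ 2 * M lam q a) i) = ∑ i ∈ s, deriv (polyExpDeriv i) t * F i q a := by
      rw [hs, Finset.sum_disjSum, Finset.sum_disjSum, ← add_assoc]
      simp only [polyExp, polyExpDeriv, F, Sum.elim_inl, Sum.elim_inr, deriv_mul_exp,
        deriv_pow_time, mul_assoc]
      congr 1
      let u : ℕ → ℝ := fun p => p * (t ^ (p - 1) * L p q a)
      have h1 : ∑ p ∈ Finset.range (2 * m + 1 + 2), u p =
          ∑ p ∈ Finset.range (2 * m + 1), u (p + 1 + 1) + u 1 + u 0 := by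
        rw [Finset.sum_range_succ', Finset.sum_range_succ']
      have h1' : ∑ p ∈ Finset.range (2 * m + 1 + 2), u p =
          ∑ p ∈ Finset.range (2 * m + 1), u p + u (2 * m + 1) + u (2 * m + 1 + 1) := by
        rw [Finset.sum_range_succ, Finset.sum_range_succ]
      have h2 : ∀ p ∈ Finset.range (2 * m + 1), powPrimitive p t *
          ((p + 1 : ℝ) * ((p + 2) * L (p + 2) q a)) =
          u (p + 1 + 1) := by
        intro p _
        have hp : (p + 1 : ℝ) ≠ 0 := by positivity
        simp only [u, powPrimitive, Nat.add_sub_cancel]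
        push_cast
        field_simp
        ring
      have hu0 : u 0 = 0 := by simp [u]
      have hu1 : u 1 = L 1 q a := by simp [u]
      have hu : ∀ p, m ≤ p → u p = 0 := fun p hp => by simp [u, hLzero p hp]
      rw [Finset.sum_congr rfl h2]
      rw [hu0, hu1] at h1
      rw [hu _ (by omega), hu _ (by omega)] at h1'
      change _ = ∑ p ∈ Finset.range (2 * m + 1), u p
      linarith
    rw [hs] at h hshift
    simp only [mul_add, Finset.sum_add_distrib] at h hshift ⊢
    linarith
  have hLrel : ∀ p < 2 * m + 1, ∀ q ∈ S.U, ∀ a, pd a (S.contrV (L p)) q =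
      -2 * (∑ b, S.symCov (L p) q a b * S.gradV q b) - (p + 1 : ℝ) * (p + 2) * L (p + 2) q a -
        2 * (S.V q - E₀) * Y (Sum.inl p) q a := by
    intro p hp q hq a
    have := (hcmp q hq a).2 (Sum.inl p) (by simpa [hs] using hp)
    simp only [Sum.elim_inl, F] at this
    linarith
  refine ⟨m, C, L, G, m, L, M,
    ⟨hG, fun k _ => hL _, X, fun p => Y (Sum.inl p), hCX, ?_, ?_, ?_, ?_⟩,
    ⟨fun k _ => hL _, fun p => Y (Sum.inl p), ?_, ?_, ?_⟩, ?_, ?_⟩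
  · intro k hk
    rw [Finset.mem_Icc] at hk
    exact hLY _ (by omega)
  · intro hm q hq a
    rw [hLrel (2 * m - 1) (by omega) q hq a, hLzero (2 * m - 1 + 2) (by omega)]
    ring
  · intro k hk hkm q hq a
    obtain ⟨k, rfl⟩ : ∃ j, k = j + 1 := ⟨k - 1, by omega⟩
    rw [show 2 * (k + 1) - 1 = 2 * k + 1 by omega, hLrel (2 * k + 1) (by omega) q hq a,
      show 2 * k + 1 + 2 = 2 * (k + 1) + 1 by ring]
    push_cast
    ring
  · intro q hq a
    have h1 : (if 0 < m then L 1 q a else 0) = L 1 q a := by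
      split_ifs with hm
      · rfl
      · exact (hLzero 1 (by omega) q a).symm
    rw [h1]
    linarith [(hcmp q hq a).1]
  · exact fun k hk => hLY _ (by omega)
  · intro q hq a
    rw [hLrel (2 * m) (by omega) q hq a, hLzero (2 * m + 2) (by omega)]
    ring
  · intro k hk q hq a
    rw [hLrel (2 * k) (by omega) q hq a]
    push_cast
    ring
  · intro lam hl
    refine ⟨hM lam hl, Y (Sum.inr lam), hMY lam hl, fun q hq a => ?_⟩
    have := (hcmp q hq a).2 (Sum.inr lam) (by simpa [hs] using hl)
    simp only [Sum.elim_inr, F] at this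
    linarith
  · obtain ⟨φ, hφ⟩ := hcongr
    refine ⟨φ, fun t q hq v => ?_⟩
    rw [← hφ t q hq v, eval_add_add_sum (K := S.familyQFI s polyExp polyExpDeriv C F G)
      (A := S.integralOne m C L G) (B := S.integralTwo m L) (Λ := Λ)
      (D := fun lam => S.integralExp lam (M lam)) (fun a b => ?_) (fun a => ?_) ?_]
    · simp only [familyQFI, integralOne, integralTwo, integralExp, hs, Finset.sum_disjSum,
        sum_range_odd_add_even, polyExp, F, Sum.elim_inl, Sum.elim_inr, powPrimitive_two_mul]
      rw [Finset.sum_congr rfl fun k hk => by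
        rw [powPrimitive_two_mul_sub_one (Finset.mem_Icc.1 hk).1]]
      ring
    · simp only [familyQFI, integralOne, integralTwo, integralExp, hs, Finset.sum_disjSum,
        sum_range_odd_add_even, polyExp, F, Sum.elim_inl, Sum.elim_inr, powPrimitive_two_mul,
        mul_neg, Finset.sum_neg_distrib]
      rw [Finset.sum_congr rfl fun k hk => by
        rw [powPrimitive_two_mul_sub_one (Finset.mem_Icc.1 hk).1]]
      ring
    · simp only [familyQFI, integralOne, integralTwo, integralExp, hs, Finset.sum_disjSum,
        sum_range_odd_add_even, polyExpDeriv, F, Sum.elim_inl, Sum.elim_inr]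
      congr 1
      exact Finset.sum_congr rfl fun lam _ => by ring

/-- In the purely exponential case the time-independent tensor `C_{ab}` of the family is trace-free
and a sum of exponentials, hence zero. -/
lemma IsExactQFI.exists_exponential_decomposition (hn : 1 ≤ n) {Λ : Finset ℝ}
    {K : QuadraticFunction n} (h0 : (0 : ℝ) ∉ Λ) (hK : S.IsExactQFI E₀ K)
    (hpoly : S.HasPolyExpCoeffs 0 Λ K) :
    ∃ (G : Coord n → ℝ) (M : ℝ → CovectorField n),
      S.SmoothScalar G ∧ (∀ q ∈ S.U, ∀ a, pd a G q = 0) ∧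
      (∀ lam ∈ Λ, S.CondExp E₀ lam (M lam)) ∧
      S.CongrShell E₀ K.eval (fun t q v =>
        G q + ∑ lam ∈ Λ, (S.integralExp lam (M lam)).eval t q v) := by
  obtain ⟨_, _, D, M', -, hDM, hcoef⟩ := hpoly
  -- type 3 has linear coefficient `lam * exp (lam * t) * M`
  let M : ℝ → CovectorField n := fun lam q a => lam⁻¹ * M' lam q a
  have hne : ∀ lam ∈ Λ, lam ≠ 0 := fun lam hl e => h0 (e ▸ hl)
  have hM : ∀ lam ∈ Λ, S.SmoothCovector (M lam) := fun lam hl => (hDM lam hl).2.const_mul _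
  have hg : ∀ lam : ℝ, ContDiff ℝ ∞ fun t => Real.exp (lam * t) := fun lam => by fun_prop
  have hlin : ∀ t, ∀ q ∈ S.U, ∀ a,
      K.lin t q a = ∑ lam ∈ Λ, lam * Real.exp (lam * t) * M lam q a := by
    intro t q hq a
    rw [(hcoef t q hq).2 a, Finset.range_zero, Finset.sum_empty, zero_add]
    refine Finset.sum_congr rfl fun lam hl => ?_
    have := hne lam hl
    simp only [M]
    field_simp
  obtain ⟨C, G, φ, hC, hG, hCtrace, hfam, hquad, hcongr⟩ :=
    hK.exists_familyQFI hn hg hasDerivAt_exp_mul hM hlin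
  have hCzero : ∀ q ∈ S.U, ∀ a b, C q a b = 0 := by
    intro q hq a b
    let T : ℝ → Fin n → Fin n → ℝ := fun lam a b => D lam q a b + S.symCov (M lam) q a b
    have hCT : ∀ t a b, C q a b =
        ∑ lam ∈ Λ, Real.exp (lam * t) * T lam a b - φ t q * S.γ q a b := by
      intro t a b
      have h1 := hquad t q hq a b
      have h2 := (hcoef t q hq).1 a b
      simp only [familyQFI, Finset.range_zero, Finset.sum_empty, zero_add] at h1 h2
      simp only [T, mul_add, Finset.sum_add_distrib]
      linarith
    have hφ : ∀ t, φ t q = (1 / n : ℝ) * ∑ lam ∈ Λ, Real.exp (lam * t) * S.trace2 q (T lam) := by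
      intro t
      have hn0 : (n : ℝ) ≠ 0 := by positivity
      have h1 := hCtrace q hq
      rw [(funext fun a => funext fun b => hCT t a b : C q = fun a b => _), trace2_sub,
        trace2_sum, trace2_mul_γ hq] at h1
      field_simp
      linarith
    refine neg_eq_zero.1 (timeIndependent_exp h0 (-C q a b) (fun lam => T lam a b -
      (1 / n : ℝ) * S.trace2 q (T lam) * S.γ q a b) fun t => ?_).1
    have h1 := hCT t a b
    rw [hφ t] at h1
    rw [h1]
    simp only [mul_sub, Finset.sum_sub_distrib, Finset.mul_sum, Finset.sum_mul]
    have e : ∀ lam ∈ Λ, Real.exp (lam * t) * ((1 / n : ℝ) * S.trace2 q (T lam) * S.γ q a b) =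
        (1 / n : ℝ) * (Real.exp (lam * t) * S.trace2 q (T lam)) * S.γ q a b :=
      fun lam _ => by ring
    rw [Finset.sum_congr rfl e]
    ring
  obtain ⟨X, Y, hCX, hMY, hrel⟩ := hfam.familyQFI_conditions hg hasDerivAt_exp_mul hC hM hG
    (timeIndependent_exp h0)
  have hX : ∀ q ∈ S.U, X q = 0 := by
    intro q hq
    have hcyc : S.cycMetric q (X q) = S.cycMetric q 0 := by
      funext a b c
      have h1 : S.cycMetric q (X q) a b c = S.cycCov C q a b c := (hCX.2 q hq a b c).symm
      rw [h1]
      simp only [cycCov, covDeriv2_congr (K' := fun _ _ _ => 0) hCzero hq]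
      simp [covDeriv2, pd_zero, cycMetric]
    rw [← assocVector_cycMetric hq (X q), hcyc, assocVector_cycMetric hq]
  have hcmp : ∀ q ∈ S.U, ∀ a, pd a G q = 0 ∧ ∀ lam ∈ Λ, lam ^ 2 * M lam q a +
      (pd a (S.contrV (M lam)) q + 2 * (∑ b, S.symCov (M lam) q a b * S.gradV q b) +
        2 * (S.V q - E₀) * Y lam q a) = 0 := by
    intro q hq a
    refine timeIndependent_exp h0 _ (fun lam => lam ^ 2 * M lam q a +
      (pd a (S.contrV (M lam)) q + 2 * (∑ b, S.symCov (M lam) q a b * S.gradV q b) +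
        2 * (S.V q - E₀) * Y lam q a)) fun t => ?_
    have h := hrel t q hq a
    simp only [hCzero q hq, hX q hq, deriv_mul_exp, Pi.zero_apply, zero_mul, Finset.sum_const_zero,
      mul_zero, add_zero] at h
    rw [← h]
    congr 1
    exact Finset.sum_congr rfl fun lam _ => by ring
  refine ⟨G, M, hG, fun q hq a => (hcmp q hq a).1, fun lam hl =>
    ⟨hM lam hl, Y lam, hMY lam hl, fun q hq a => by linarith [(hcmp q hq a).2 lam hl]⟩, ?_⟩
  obtain ⟨φ, hφ⟩ := hcongr
  refine ⟨φ, fun t q hq v => ?_⟩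
  rw [← hφ t q hq v, eval_add_add_sum
    (K := S.familyQFI Λ (fun lam t => Real.exp (lam * t))
      (fun lam t => lam * Real.exp (lam * t)) C M G)
    (A := ⟨fun _ _ _ _ => 0, fun _ _ _ => 0, fun _ q => G q⟩)
    (B := ⟨fun _ _ _ _ => 0, fun _ _ _ => 0, fun _ _ => 0⟩) (Λ := Λ)
    (D := fun lam => S.integralExp lam (M lam)) (fun a b => ?_) (fun a => ?_) ?_]
  · simp [QuadraticFunction.eval]
  · simp [familyQFI, integralExp]
  · simp [familyQFI, integralExp, hCzero q hq]
  · simp only [familyQFI, integralExp, zero_add]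
    exact Finset.sum_congr rfl fun lam _ => by ring

/-! ### Independence of the types -/

lemma lin_eq_zero_of_congrShell {κ : Type*} {Λ : Finset κ} {A B : QuadraticFunction n}
    {D : κ → QuadraticFunction n}
    (h : S.CongrShell E₀ (fun t q v => A.eval t q v + B.eval t q v + ∑ i ∈ Λ, (D i).eval t q v)
      (fun _ _ _ => 0)) (t : ℝ) (hq : q ∈ S.U) (a : Fin n) :
    A.lin t q a + B.lin t q a + ∑ i ∈ Λ, (D i).lin t q a = 0 := by
  obtain ⟨φ, hφ⟩ := h
  let T : QuadraticFunction n :=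
    ⟨fun t q a b => A.quad t q a b + B.quad t q a b + ∑ i ∈ Λ, (D i).quad t q a b,
      fun t q a => A.lin t q a + B.lin t q a + ∑ i ∈ Λ, (D i).lin t q a,
      fun t q => A.scal t q + B.scal t q + ∑ i ∈ Λ, (D i).scal t q⟩
  have hT : ∀ v, T.eval t q v = φ t q * S.shell E₀ q v := fun v => by
    rw [← hφ t q hq v, sub_zero]
    exact eval_add_add_sum (fun _ _ => rfl) (fun _ => rfl) rfl v
  -- the linear part is the part odd in the velocity, and the constraint is even
  refine linearForm_eq_zero (T := T.lin t q) (fun v => ?_) a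
  have h1 := hT v
  have h2 := hT (-v)
  simp only [QuadraticFunction.eval, shell, Pi.neg_apply, mul_neg, neg_mul, neg_neg,
    Finset.sum_neg_distrib] at h1 h2
  linarith

/-- The covectors generating the summands of type 2 and 3 in a vanishing sum are zero, since the
linear part of the sum is a polynomial and exponential function of time whose coefficients are these
covectors (those of type 2 at the even powers). -/
lemma covectors_eq_zero {ℓ₁ ℓ₂ : ℕ} {C : TensorField2 n} {L₁ L₂ : ℕ → CovectorField n}
    {G : Coord n → ℝ} {Λ : Finset ℝ} {M : ℝ → CovectorField n} (h0 : (0 : ℝ) ∉ Λ)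
    (h : S.CongrShell E₀ (fun t q v =>
      (S.integralOne ℓ₁ C L₁ G).eval t q v + (S.integralTwo ℓ₂ L₂).eval t q v +
        ∑ lam ∈ Λ, (S.integralExp lam (M lam)).eval t q v) (fun _ _ _ => 0)) :
    (∀ k ≤ ℓ₂, ∀ q ∈ S.U, ∀ a, L₂ (2 * k) q a = 0) ∧
      ∀ lam ∈ Λ, ∀ q ∈ S.U, ∀ a, M lam q a = 0 := by
  have key : ∀ q ∈ S.U, ∀ a, (∀ k ≤ ℓ₂, L₂ (2 * k) q a = 0) ∧ ∀ lam ∈ Λ, M lam q a = 0 := by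
    intro q hq a
    obtain ⟨hP, hd⟩ := polynomial_exp_independent Λ h0
      ((∑ k ∈ Finset.Icc 1 ℓ₁, Polynomial.C (L₁ (2 * k - 1) q a) * Polynomial.X ^ (2 * k - 1)) +
        ∑ k ∈ Finset.range (ℓ₂ + 1), Polynomial.C (L₂ (2 * k) q a) * Polynomial.X ^ (2 * k))
      (fun lam => lam * M lam q a) (fun t => by
        rw [← lin_eq_zero_of_congrShell h t hq a]
        simp only [integralOne, integralTwo, integralExp, Polynomial.eval_add,
          Polynomial.eval_finsetSum, Polynomial.eval_mul, Polynomial.eval_C, Polynomial.eval_pow,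
          Polynomial.eval_X]
        congr 1
        congr 1 <;> exact Finset.sum_congr rfl fun _ _ => mul_comm _ _)
    refine ⟨fun k hk => ?_, fun lam hl => ?_⟩
    · have h1 := congrArg (fun P => Polynomial.coeff P (2 * k)) hP
      simp only [Polynomial.coeff_add, Polynomial.finsetSum_coeff, Polynomial.coeff_C_mul,
        Polynomial.coeff_X_pow, mul_ite, mul_one, mul_zero, Polynomial.coeff_zero] at h1
      rw [Finset.sum_eq_zero, zero_add, Finset.sum_eq_single k] at h1
      · simpa using h1
      · intro j _ hj
        exact if_neg (by omega)
      · intro hk'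
        simp only [Finset.mem_range] at hk'
        omega
      · intro j hj
        rw [Finset.mem_Icc] at hj
        exact if_neg (by omega)
    · exact (mul_eq_zero.1 (hd lam hl)).resolve_left fun e => h0 (e ▸ hl)
  exact ⟨fun k hk q hq a => (key q hq a).1 k hk, fun lam hl q hq a => (key q hq a).2 lam hl⟩

lemma integralTwo_eval_eq_zero {ℓ : ℕ} {L : ℕ → CovectorField n}
    (hL : ∀ k ≤ ℓ, ∀ q ∈ S.U, ∀ a, L (2 * k) q a = 0) (t : ℝ) (hq : q ∈ S.U) (v : Coord n) :
    (S.integralTwo ℓ L).eval t q v = 0 := by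
  have hk : ∀ k ∈ Finset.range (ℓ + 1), k ≤ ℓ := fun k hk => by
    simp only [Finset.mem_range] at hk; omega
  have h2 : ∀ a b, (S.integralTwo ℓ L).quad t q a b = 0 := fun a b => by
    simp only [integralTwo]
    exact Finset.sum_eq_zero fun k h => by
      rw [symCov_congr (L' := fun _ _ => 0) (hL k (hk k h)) hq, symCov_zero, mul_zero, neg_zero]
  have h1 : ∀ a, (S.integralTwo ℓ L).lin t q a = 0 := fun a => by
    simp only [integralTwo]
    exact Finset.sum_eq_zero fun k h => by rw [hL k (hk k h) q hq, mul_zero]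
  have h0 : (S.integralTwo ℓ L).scal t q = 0 := by
    simp only [integralTwo]
    exact Finset.sum_eq_zero fun k h => by
      rw [contrV_congr (L' := fun _ _ => 0) (hL k (hk k h) q hq), contrV_zero, mul_zero]
  simp [QuadraticFunction.eval, h2, h1, h0]

lemma integralExp_eval_eq_zero {lam : ℝ} {L : CovectorField n}
    (hL : ∀ q ∈ S.U, ∀ a, L q a = 0) (t : ℝ) (hq : q ∈ S.U) (v : Coord n) :
    (S.integralExp lam L).eval t q v = 0 := by
  simp [QuadraticFunction.eval, integralExp, symCov_congr (L' := fun _ _ => 0) hL hq, symCov_zero,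
    contrV_congr (L' := fun _ _ => 0) (hL q hq), contrV_zero, hL q hq]

end ConservativeSystem

theorem theorem1 (n : ℕ) (hn : 1 ≤ n) (S : ConservativeSystem n) (E₀ : ℝ) :
    -- exact quadratic first integrals are constant along the constrained motions
    (∀ K : QuadraticFunction n, S.IsExactQFI E₀ K → S.IsConserved E₀ K.eval) ∧
    -- each of the three types consists of exact quadratic first integrals
    (∀ (ℓ : ℕ) (C : TensorField2 n) (L : ℕ → CovectorField n) (G : Coord n → ℝ),
      S.CondOne E₀ ℓ C L G → S.IsExactQFI E₀ (S.integralOne ℓ C L G)) ∧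
    (∀ (ℓ : ℕ) (L : ℕ → CovectorField n),
      S.CondTwo E₀ ℓ L → S.IsExactQFI E₀ (S.integralTwo ℓ L)) ∧
    (∀ (lam : ℝ) (L : CovectorField n), lam ≠ 0 →
      S.CondExp E₀ lam L → S.IsExactQFI E₀ (S.integralExp lam L)) ∧
    -- there are no others: modulo the energy constraint, an exact quadratic first integral with
    -- polynomial and exponential coefficients is a sum of integrals of the three types
    (∀ (m : ℕ) (Λ : Finset ℝ) (K : QuadraticFunction n), (0 : ℝ) ∉ Λ →
      S.IsExactQFI E₀ K → S.HasPolyExpCoeffs m Λ K →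
      ∃ (ℓ₁ : ℕ) (C : TensorField2 n) (L₁ : ℕ → CovectorField n) (G : Coord n → ℝ)
        (ℓ₂ : ℕ) (L₂ : ℕ → CovectorField n) (M : ℝ → CovectorField n),
        S.CondOne E₀ ℓ₁ C L₁ G ∧ S.CondTwo E₀ ℓ₂ L₂ ∧ (∀ lam ∈ Λ, S.CondExp E₀ lam (M lam)) ∧
        S.CongrShell E₀ K.eval (fun t q v =>
          (S.integralOne ℓ₁ C L₁ G).eval t q v + (S.integralTwo ℓ₂ L₂).eval t q v +
            ∑ lam ∈ Λ, (S.integralExp lam (M lam)).eval t q v)) ∧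
    -- with purely exponential coefficients only integrals of the third type occur, up to a
    -- (locally) constant function
    (∀ (Λ : Finset ℝ) (K : QuadraticFunction n), (0 : ℝ) ∉ Λ →
      S.IsExactQFI E₀ K → S.HasPolyExpCoeffs 0 Λ K →
      ∃ (G : Coord n → ℝ) (M : ℝ → CovectorField n),
        S.SmoothScalar G ∧ (∀ q ∈ S.U, ∀ a, pd a G q = 0) ∧
        (∀ lam ∈ Λ, S.CondExp E₀ lam (M lam)) ∧
        S.CongrShell E₀ K.eval (fun t q v =>
          G q + ∑ lam ∈ Λ, (S.integralExp lam (M lam)).eval t q v)) ∧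
    -- the types are independent: if a sum vanishes modulo the constraint, so does each summand
    (∀ (ℓ₁ : ℕ) (C : TensorField2 n) (L₁ : ℕ → CovectorField n) (G : Coord n → ℝ)
      (ℓ₂ : ℕ) (L₂ : ℕ → CovectorField n) (Λ : Finset ℝ) (M : ℝ → CovectorField n),
      (0 : ℝ) ∉ Λ →
      S.CondOne E₀ ℓ₁ C L₁ G → S.CondTwo E₀ ℓ₂ L₂ → (∀ lam ∈ Λ, S.CondExp E₀ lam (M lam)) →
      S.CongrShell E₀ (fun t q v =>
        (S.integralOne ℓ₁ C L₁ G).eval t q v + (S.integralTwo ℓ₂ L₂).eval t q v +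
          ∑ lam ∈ Λ, (S.integralExp lam (M lam)).eval t q v) (fun _ _ _ => 0) →
      S.CongrShell E₀ (S.integralOne ℓ₁ C L₁ G).eval (fun _ _ _ => 0) ∧
      S.CongrShell E₀ (S.integralTwo ℓ₂ L₂).eval (fun _ _ _ => 0) ∧
      ∀ lam ∈ Λ, S.CongrShell E₀ (S.integralExp lam (M lam)).eval (fun _ _ _ => 0)) := by
  refine ⟨fun K hK => hK.isConserved, fun ℓ C L G h => h.isExactQFI, fun ℓ L h => h.isExactQFI,
    fun lam L _ h => h.isExactQFI,
    fun m Λ K h0 hK hpoly => hK.exists_decomposition hn h0 hpoly,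
    fun Λ K h0 hK hpoly => hK.exists_exponential_decomposition hn h0 hpoly,
    fun ℓ₁ C L₁ G ℓ₂ L₂ Λ M h0 _ _ _ h => ?_⟩
  obtain ⟨hL₂, hM⟩ := ConservativeSystem.covectors_eq_zero h0 h
  have two : ∀ t, ∀ q ∈ S.U, ∀ v, (S.integralTwo ℓ₂ L₂).eval t q v = 0 := fun t q hq v =>
    ConservativeSystem.integralTwo_eval_eq_zero hL₂ t hq v
  have exp : ∀ lam ∈ Λ, ∀ t, ∀ q ∈ S.U, ∀ v, (S.integralExp lam (M lam)).eval t q v = 0 :=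
    fun lam hl t q hq v => ConservativeSystem.integralExp_eval_eq_zero (hM lam hl) t hq v
  refine ⟨?_, ⟨0, fun t q hq v => by simp [two t q hq]⟩,
    fun lam hl => ⟨0, fun t q hq v => by simp [exp lam hl t q hq]⟩⟩
  -- the summands of type 2 and 3 being zero, the relation is one for the summand of type 1
  obtain ⟨φ, hφ⟩ := h
  refine ⟨φ, fun t q hq v => ?_⟩
  rw [← hφ t q hq v]
  beta_reduce
  rw [two t q hq, Finset.sum_eq_zero fun lam hl => exp lam hl t q hq v]
  simp

end
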